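/- **Setting.** All Hilbert spaces are finite-dimensional and nonzero. Three parties $A,B,C$ have input systems $A_1,B_1,C_1$ and output systems $A_2,B_2,C_2$, and $d_S$ denotes the dimension of a system $S$. A CPTP operator of a party $X$ is an operator $M^{X_1X_2}\ge 0$ with $\mathrm{Tr}_{X_2}M=\mathbb 1^{X_1}$ (the Choi–Jamiołkowski operator of a channel); an event of $X$ is an operator $M^{X_1X_2}\ge 0$ with $\mathrm{Tr}_{X_2}M\le\mathbb 1^{X_1}$. A process matrix is an operator $W\ge 0$ on the tensor product of the input and output systems of all parties such that $\mathrm{Tr}[W\,(M^{A_1A_2}\otimes M^{B_1B_2}\otimes\cdots)]=1$ for all CPTP operators. There is no signaling from a set of parties to the remaining ones if, for all events of the remaining parties, $\mathrm{Tr}[W(\cdots)]$ does not depend on which CPTP operators are inserted for the parties in the set. A bipartite process matrix is *causally separable* if it equals $qV+(1-q)V'$ with $0\le q\le1$ and process matrices $V,V'$ such that $V$ has no signaling from $A$ to $B$ and $V'$ has no signaling from $B$ to $A$. A tripartite process matrix $W$ is *causally separable with $C$ first* if it has no signaling from $A,B$ to $C$ and, for each event $M$ of $C$ with $p(M)=\mathrm{Tr}[W(\mathbb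 1^{A_1A_2B_1B_2}\otimes M)]/(d_{A_2}d_{B_2})\neq 0$, the conditional process matrix $\mathrm{Tr}_{C_1C_2}[W(\mathbb 1^{A_1A_2B_1B_2}\otimes M)]/p(M)$ is causally separable; similarly with $B$ or $A$ first. $W$ is *causally separable* if it is a convex combination of three process matrices that are causally separable with $C$, $B$, $A$ first, respectively. $W$ is *extensibly causally separable (ECS)* if it is causally separable and, for all finite-dimensional ancillas $A',B',C'$ and all density operators $\rho^{A'B'C'}$, the process matrix $W\otimes\rho^{A'B'C'}$ of the parties with input systems $A_1A'$, $B_1B'$, $C_1C'$ is causally separable. A term of type $S$, where $S$ is a set of systems, is a tensor product of a traceless Hermitian operator on each system in $S$ and the identity on each of the other systems; an operator contains no terms of type $S$ if it is Hilbert–Schmidt orthogonal to all of them. The types *allowed for $C$ first* are the following 30 (a product denotes the set of its systems, and $\mathbb 1$ the empty set): $\mathbb 1$, $C_1$, and each of $A_1$, $B_1$, $A_1B_1$, $A_2B_1$, $A_1B_2$, $A_1A_2B_1$, $A_1B_1B_2$ combined with one of $\mathbb 1$, $C_1$, $C_2$, $C_1C_2$. A process matrix has the *form $(A,B)\npreceq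 C$* if it contains only terms of types allowed for $C$ first and equals $$\mathbb 1^{A_2}\otimes\tilde W^{A_1B_1B_2C_1C_2}+\mathbb 1^{B_2}\otimes\tilde W^{A_1A_2B_1C_1C_2}$$ for some positive semidefinite operators $\tilde W^{A_1B_1B_2C_1C_2}$ and $\tilde W^{A_1A_2B_1C_1C_2}$. The forms $(A,C)\npreceq B$ and $(B,C)\npreceq A$ are defined by permuting the parties. **Proposition 3.3.** Every tripartite ECS process matrix can be written as $$W=q_1W_{(A,B)\npreceq C}+q_2W_{(A,C)\npreceq B}+q_3W_{(B,C)\npreceq A},\qquad q_i\ge 0,\quad q_1+q_2+q_3=1,$$ where $W_{(A,B)\npreceq C}$ is an ECS process matrix that is causally separable with $C$ first and has the form $(A,B)\npreceq C$, and analogously for $W_{(A,C)\npreceq B}$ and $W_{(B,C)\npreceq A}$ by permutation. Conversely, every convex combination of three process matrices of the forms $(A,B)\npreceq C$, $(A,C)\npreceq B$ and $(B,C)\npreceq A$ is an ECS process matrix. -/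

import Mathlib

open scoped Kronecker ComplexOrder

noncomputable section

namespace ProcMat

/-! Conventions. A finite-dimensional Hilbert space with a fixed orthonormal basis is represented
by the finite type indexing that basis, operators by complex matrices. The laboratory of a party
`X` has input `X1` and output `X2`, and operators on it are indexed by `X1 × X2`. -/

/-! ### Local operations, through their Choi-Jamiolkowski operators -/

section Local

variable {X1 X2 : Type} [Fintype X1] [DecidableEq X1] [Fintype X2]

/-- Partial trace over the output system of a laboratory. -/
def trOut (M : Matrix (X1 × X2) (X1 × X2) ℂ) : Matrix X1 X1 ℂ :=
  Matrix.of fun i j => ∑ k, M (i, k) (j, k)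

/-- Choi operator of a completely positive trace-preserving map from `X1` to `X2`: the total
operation of a setting, all outcomes summed. -/
def IsCPTP (M : Matrix (X1 × X2) (X1 × X2) ℂ) : Prop :=
  M.PosSemidef ∧ trOut M = 1

/-- Choi operator of a completely positive trace-non-increasing map, that is, of one outcome of a
quantum operation (an event). -/
def IsEvent (M : Matrix (X1 × X2) (X1 × X2) ℂ) : Prop :=
  M.PosSemidef ∧ (1 - trOut M).PosSemidef

end Local

/-! ### Bipartite quantum processes -/

section Bipartite

variable {A1 A2 B1 B2 : Type} [Fintype A1] [DecidableEq A1] [Fintype A2]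
  [Fintype B1] [DecidableEq B1] [Fintype B2]

/-- The joint probability `Tr [W (M_A ⊗ M_B)]`. -/
def prob₂ (W : Matrix ((A1 × A2) × (B1 × B2)) ((A1 × A2) × (B1 × B2)) ℂ)
    (MA : Matrix (A1 × A2) (A1 × A2) ℂ) (MB : Matrix (B1 × B2) (B1 × B2) ℂ) : ℂ :=
  (W * (MA ⊗ₖ MB)).trace

/-- Bipartite process matrices: positive semidefinite, with probabilities summing to one. -/
def IsProcMatrix₂ (W : Matrix ((A1 × A2) × (B1 × B2)) ((A1 × A2) × (B1 × B2)) ℂ) : Prop :=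
  W.PosSemidef ∧ ∀ MA MB, IsCPTP MA → IsCPTP MB → prob₂ W MA MB = 1

/-- No signaling from Alice to Bob: the probability of every event of Bob, summed over the
outcomes of Alice, does not depend on the operation (setting) chosen by Alice. -/
def NoSigAtoB (W : Matrix ((A1 × A2) × (B1 × B2)) ((A1 × A2) × (B1 × B2)) ℂ) : Prop :=
  ∀ MA MA' MB, IsCPTP MA → IsCPTP MA' → IsEvent MB → prob₂ W MA MB = prob₂ W MA' MB

/-- No signaling from Bob to Alice. -/
def NoSigBtoA (W : Matrix ((A1 × A2) × (B1 × B2)) ((A1 × A2) × (B1 × B2)) ℂ) : Prop :=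
  ∀ MA MB MB', IsEvent MA → IsCPTP MB → IsCPTP MB' → prob₂ W MA MB = prob₂ W MA MB'

/-- Bipartite causal separability: a convex combination of a quantum process without signaling
from Alice to Bob (Bob first) and one without signaling from Bob to Alice (Alice first). The
remaining conditional processes are monopartite, for which causal separability is automatic. -/
def IsCausallySeparable₂
    (W : Matrix ((A1 × A2) × (B1 × B2)) ((A1 × A2) × (B1 × B2)) ℂ) : Prop :=
  ∃ (q : ℝ) (V V' : Matrix ((A1 × A2) × (B1 × B2)) ((A1 × A2) × (B1 × B2)) ℂ),
    0 ≤ q ∧ q ≤ 1 ∧ W = q • V + (1 - q) • V' ∧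
    (IsProcMatrix₂ V ∧ NoSigAtoB V) ∧ (IsProcMatrix₂ V' ∧ NoSigBtoA V')

end Bipartite

/-! ### Relabelings of three parties -/

/-- The same tripartite operator, with the parties listed in the order `A, C, B`. -/
def toACB {α β γ : Type} (W : Matrix (α × β × γ) (α × β × γ) ℂ) :
    Matrix (α × γ × β) (α × γ × β) ℂ :=
  W.submatrix (fun x => (x.1, x.2.2, x.2.1)) (fun x => (x.1, x.2.2, x.2.1))

/-- The same tripartite operator, with the parties listed in the order `B, C, A`. -/
def toBCA {α β γ : Type} (W : Matrix (α × β × γ) (α × β × γ) ℂ) :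
    Matrix (β × γ × α) (β × γ × α) ℂ :=
  W.submatrix (fun x => (x.2.2, x.1, x.2.1)) (fun x => (x.2.2, x.1, x.2.1))

/-! ### Tripartite quantum processes -/

section Tripartite

variable {A1 A2 B1 B2 C1 C2 : Type}
  [Fintype A1] [DecidableEq A1] [Fintype A2] [DecidableEq A2]
  [Fintype B1] [DecidableEq B1] [Fintype B2] [DecidableEq B2]
  [Fintype C1] [DecidableEq C1] [Fintype C2] [DecidableEq C2]

/-- The joint probability `Tr [W (M_A ⊗ M_B ⊗ M_C)]`. -/
def prob₃
    (W : Matrix ((A1 × A2) × (B1 × B2) × (C1 × C2)) ((A1 × A2) × (B1 × B2) × (C1 × C2)) ℂ)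
    (MA : Matrix (A1 × A2) (A1 × A2) ℂ) (MB : Matrix (B1 × B2) (B1 × B2) ℂ)
    (MC : Matrix (C1 × C2) (C1 × C2) ℂ) : ℂ :=
  (W * (MA ⊗ₖ (MB ⊗ₖ MC))).trace

/-- Tripartite process matrices: positive semidefinite, with probabilities summing to one. -/
def IsProcMatrix₃
    (W : Matrix ((A1 × A2) × (B1 × B2) × (C1 × C2)) ((A1 × A2) × (B1 × B2) × (C1 × C2)) ℂ) :
    Prop :=
  W.PosSemidef ∧
    ∀ MA MB MC, IsCPTP MA → IsCPTP MB → IsCPTP MC → prob₃ W MA MB MC = 1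

/-- No signaling from Alice and Bob (the first two parties) to Charlie (the third party). -/
def NoSigABtoC
    (W : Matrix ((A1 × A2) × (B1 × B2) × (C1 × C2)) ((A1 × A2) × (B1 × B2) × (C1 × C2)) ℂ) :
    Prop :=
  ∀ MA MA' MB MB' MC, IsCPTP MA → IsCPTP MA' → IsCPTP MB → IsCPTP MB' → IsEvent MC →
    prob₃ W MA MB MC = prob₃ W MA' MB' MC

/-- The reduced process of Charlie, `Tr_{A1 A2 B1 B2} W / (d_{A2} d_{B2})`. -/
def reducedC
    (W : Matrix ((A1 × A2) × (B1 × B2) × (C1 × C2)) ((A1 × A2) × (B1 × B2) × (C1 × C2)) ℂ) :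
    Matrix (C1 × C2) (C1 × C2) ℂ :=
  ((Fintype.card A2 : ℂ) * (Fintype.card B2 : ℂ))⁻¹ •
    Matrix.of fun c c' => ∑ a : A1 × A2, ∑ b : B1 × B2, W (a, b, c) (a, b, c')

/-- The probability `Tr [W^{C1 C2} M]` of the event `M` of Charlie in his reduced process. -/
def probC
    (W : Matrix ((A1 × A2) × (B1 × B2) × (C1 × C2)) ((A1 × A2) × (B1 × B2) × (C1 × C2)) ℂ)
    (M : Matrix (C1 × C2) (C1 × C2) ℂ) : ℂ :=
  (reducedC W * M).trace

/-- The unnormalized conditional operator `Tr_{C1 C2} [W (1 ⊗ M)]` of Alice and Bob. -/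
def traceC
    (W : Matrix ((A1 × A2) × (B1 × B2) × (C1 × C2)) ((A1 × A2) × (B1 × B2) × (C1 × C2)) ℂ)
    (M : Matrix (C1 × C2) (C1 × C2) ℂ) :
    Matrix ((A1 × A2) × (B1 × B2)) ((A1 × A2) × (B1 × B2)) ℂ :=
  Matrix.of fun x y => ∑ c, ∑ c', W (x.1, x.2, c) (y.1, y.2, c') * M c' c

/-- The conditional process matrix of Alice and Bob given the event `M` of Charlie. -/
def condAB
    (W : Matrix ((A1 × A2) × (B1 × B2) × (C1 × C2)) ((A1 × A2) × (B1 × B2) × (C1 × C2)) ℂ)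
    (M : Matrix (C1 × C2) (C1 × C2) ℂ) :
    Matrix ((A1 × A2) × (B1 × B2)) ((A1 × A2) × (B1 × B2)) ℂ :=
  (probC W M)⁻¹ • traceC W M

/-- A quantum process of the form `𝒲_cs^{A,B|C} ∘ 𝒲^C`: a process matrix without signaling from
the first two parties to the third, whose conditional process is causally separable for every
event of the third party that has nonzero probability. -/
def IsCausallySeparableLastFirst
    (W : Matrix ((A1 × A2) × (B1 × B2) × (C1 × C2)) ((A1 × A2) × (B1 × B2) × (C1 × C2)) ℂ) :
    Prop :=
  IsProcMatrix₃ W ∧ NoSigABtoC W ∧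
    ∀ M, IsEvent M → probC W M ≠ 0 → IsCausallySeparable₂ (condAB W M)

/-- Tripartite causal separability: a convex combination of three quantum processes, in each of
which one designated party is first and the conditional process of the other two is causally
separable. -/
def IsCausallySeparable₃
    (W : Matrix ((A1 × A2) × (B1 × B2) × (C1 × C2)) ((A1 × A2) × (B1 × B2) × (C1 × C2)) ℂ) :
    Prop :=
  ∃ (q₁ q₂ q₃ : ℝ)
    (W₁ W₂ W₃ :
      Matrix ((A1 × A2) × (B1 × B2) × (C1 × C2)) ((A1 × A2) × (B1 × B2) × (C1 × C2)) ℂ),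
    0 ≤ q₁ ∧ 0 ≤ q₂ ∧ 0 ≤ q₃ ∧ q₁ + q₂ + q₃ = 1 ∧
    W = q₁ • W₁ + q₂ • W₂ + q₃ • W₃ ∧
    IsCausallySeparableLastFirst W₁ ∧
    IsCausallySeparableLastFirst (toACB W₂) ∧
    IsCausallySeparableLastFirst (toBCA W₃)

/-- The extension `W ⊗ ρ` of a process matrix by input ancillas `A'`, `B'`, `C'` in the joint state
`ρ`; the extended parties have input systems `A1 A'`, `B1 B'`, `C1 C'`. -/
def extend {A' B' C' : Type}
    (W : Matrix ((A1 × A2) × (B1 × B2) × (C1 × C2)) ((A1 × A2) × (B1 × B2) × (C1 × C2)) ℂ)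
    (ρ : Matrix (A' × B' × C') (A' × B' × C') ℂ) :
    Matrix (((A1 × A') × A2) × ((B1 × B') × B2) × ((C1 × C') × C2))
      (((A1 × A') × A2) × ((B1 × B') × B2) × ((C1 × C') × C2)) ℂ :=
  Matrix.of fun x y =>
    W ((x.1.1.1, x.1.2), (x.2.1.1.1, x.2.1.2), (x.2.2.1.1, x.2.2.2))
      ((y.1.1.1, y.1.2), (y.2.1.1.1, y.2.1.2), (y.2.2.1.1, y.2.2.2)) *
    ρ (x.1.1.2, x.2.1.1.2, x.2.2.1.2) (y.1.1.2, y.2.1.1.2, y.2.2.1.2)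

/-- Extensibly causally separable (ECS) tripartite process matrices: causally separable, and
causally separable after extension with input ancillas in an arbitrary joint quantum state. -/
def IsECS
    (W : Matrix ((A1 × A2) × (B1 × B2) × (C1 × C2)) ((A1 × A2) × (B1 × B2) × (C1 × C2)) ℂ) :
    Prop :=
  IsCausallySeparable₃ W ∧
    ∀ (A' B' C' : Type) [Fintype A'] [DecidableEq A'] [Fintype B'] [DecidableEq B']
      [Fintype C'] [DecidableEq C'] (ρ : Matrix (A' × B' × C') (A' × B' × C') ℂ),
      ρ.PosSemidef → ρ.trace = 1 → IsCausallySeparable₃ (extend W ρ)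

/-! ### Types of Hilbert-Schmidt terms -/

/-- A tensor factor of a Hilbert-Schmidt term: the identity if it is trivial (`t = false`), a
traceless Hermitian operator, that is, a real multiple of a nontrivial member of some
Hilbert-Schmidt basis, if it is nontrivial (`t = true`). -/
def IsFactor {X : Type} [Fintype X] [DecidableEq X] (t : Bool) (σ : Matrix X X ℂ) : Prop :=
  σ.IsHermitian ∧ (t = true → σ.trace = 0) ∧ (t = false → σ = 1)

/-- `W` contains no term of the type with nontrivial factors exactly on the systems marked `true`:
its Hilbert-Schmidt coefficient along every such term vanishes. -/
def HasNoTerm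
    (W : Matrix ((A1 × A2) × (B1 × B2) × (C1 × C2)) ((A1 × A2) × (B1 × B2) × (C1 × C2)) ℂ)
    (a₁ a₂ b₁ b₂ c₁ c₂ : Bool) : Prop :=
  ∀ (σA1 : Matrix A1 A1 ℂ) (σA2 : Matrix A2 A2 ℂ) (σB1 : Matrix B1 B1 ℂ)
    (σB2 : Matrix B2 B2 ℂ) (σC1 : Matrix C1 C1 ℂ) (σC2 : Matrix C2 C2 ℂ),
    IsFactor a₁ σA1 → IsFactor a₂ σA2 → IsFactor b₁ σB1 → IsFactor b₂ σB2 →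
    IsFactor c₁ σC1 → IsFactor c₂ σC2 →
    (W * ((σA1 ⊗ₖ σA2) ⊗ₖ ((σB1 ⊗ₖ σB2) ⊗ₖ (σC1 ⊗ₖ σC2)))).trace = 0

/-- The 30 types of terms allowed when Charlie is first: `1`, `C1`, and all types of the form
`S T` with `S` one of `A1`, `B1`, `A1 B1`, `A2 B1`, `A1 B2`, `A1 A2 B1`, `A1 B1 B2` and `T` one of
`1`, `C1`, `C2`, `C1 C2`. The types `S` are those with a nontrivial factor on the input and a
trivial one on the output of Alice or of Bob. -/
def AllowedCFirst (a₁ a₂ b₁ b₂ _c₁ c₂ : Bool) : Prop :=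
  (a₁ = true ∧ a₂ = false) ∨ (b₁ = true ∧ b₂ = false) ∨
    (a₁ = false ∧ a₂ = false ∧ b₁ = false ∧ b₂ = false ∧ c₂ = false)

/-- `W` contains only terms of the types allowed when Charlie is first. -/
def OnlyCFirstTerms
    (W : Matrix ((A1 × A2) × (B1 × B2) × (C1 × C2)) ((A1 × A2) × (B1 × B2) × (C1 × C2)) ℂ) :
    Prop :=
  ∀ a₁ a₂ b₁ b₂ c₁ c₂, ¬ AllowedCFirst a₁ a₂ b₁ b₂ c₁ c₂ → HasNoTerm W a₁ a₂ b₁ b₂ c₁ c₂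

/-! ### The canonical form -/

/-- `1^{A2} ⊗ V` for an operator `V` on `A1 B1 B2 C1 C2`. -/
def idA2 (V : Matrix (A1 × (B1 × B2) × (C1 × C2)) (A1 × (B1 × B2) × (C1 × C2)) ℂ) :
    Matrix ((A1 × A2) × (B1 × B2) × (C1 × C2)) ((A1 × A2) × (B1 × B2) × (C1 × C2)) ℂ :=
  Matrix.of fun x y =>
    (1 : Matrix A2 A2 ℂ) x.1.2 y.1.2 * V (x.1.1, x.2.1, x.2.2) (y.1.1, y.2.1, y.2.2)

/-- `1^{B2} ⊗ V` for an operator `V` on `A1 A2 B1 C1 C2`. -/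
def idB2 (V : Matrix ((A1 × A2) × B1 × (C1 × C2)) ((A1 × A2) × B1 × (C1 × C2)) ℂ) :
    Matrix ((A1 × A2) × (B1 × B2) × (C1 × C2)) ((A1 × A2) × (B1 × B2) × (C1 × C2)) ℂ :=
  Matrix.of fun x y =>
    (1 : Matrix B2 B2 ℂ) x.2.1.2 y.2.1.2 * V (x.1, x.2.1.1, x.2.2) (y.1, y.2.1.1, y.2.2)

/-- The canonical form for the third party first: a (properly normalized) process matrix containing
only terms allowed when Charlie is first, and equal to `1^{A2} ⊗ V + 1^{B2} ⊗ V'` with `V`, `V'`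
positive semidefinite. -/
def HasLastFirstForm
    (W : Matrix ((A1 × A2) × (B1 × B2) × (C1 × C2)) ((A1 × A2) × (B1 × B2) × (C1 × C2)) ℂ) :
    Prop :=
  IsProcMatrix₃ W ∧ OnlyCFirstTerms W ∧
    ∃ (V : Matrix (A1 × (B1 × B2) × (C1 × C2)) (A1 × (B1 × B2) × (C1 × C2)) ℂ)
      (V' : Matrix ((A1 × A2) × B1 × (C1 × C2)) ((A1 × A2) × B1 × (C1 × C2)) ℂ),
      V.PosSemidef ∧ V'.PosSemidef ∧ W = idA2 V + idB2 V'

end Tripartite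

end ProcMat

end

/-! Everything is rephrased linearly. Events span all operators on a laboratory, and channels span
the operators whose output trace is a multiple of the identity. So normalization and no signaling
become multilinear identities (`isProcMatrix₃_iff`, `noSigABtoC_iff`). For normalized `W`, no
signaling to Charlie is the same as containing only the allowed terms
(`IsNoSigLinear.onlyCFirstTerms`, `OnlyCFirstTerms.isNoSigLinear`).

Sufficiency. Tracing a process in canonical form against an event of Charlie leaves two positive
operators, one trivial on `A2` and one trivial on `B2`. No signaling to Charlie normalizes their
sum, and this forces each summand to be normalized up to a scalar, hence causal separability
(`isCausallySeparable₂_of_add`). The form survives tensoring with any ancilla state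
(`HasLastFirstForm.extend`), so it implies ECS.

Necessity. Extend `W` by a GHZ state on local ancillas `K` large enough to contain a copy of every
laboratory. It is symmetric in the parties, so one state serves all three causal orders. Each
positive-weight component of a causal decomposition of `W ⊗ GHZ` is dominated by it; as GHZ is pure,
the component is itself some `F ⊗ GHZ` (`eq_kronecker_of_dominated`). In a component with Charlie
first, let him project his laboratory and ancilla onto an entangled vector. GHZ correlations then
transfer `C1 C2` coherently to the ancillas of Alice and Bob, so their conditional process contains
all of `F` as a compression (`traceC_extend_ghz_swapEffect`). That process is causally separable,
hence of the form `1^{A2} ⊗ R + 1^{B2} ⊗ R'`. The ancillas are inputs, so compressing them leaves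
the identities on `A2` and `B2` intact and yields the canonical form of `F`
(`hasLastFirstForm_of_extend_ghz`). -/

noncomputable section

set_option linter.unusedSectionVars false

namespace ProcMat

/-! ### Positive semidefinite matrices -/

section PosSemidef

open Matrix

section Loewner

open scoped MatrixOrder Matrix.Norms.L2Operator

/-- The identity is interior to the positive cone: `H ≥ -‖H‖`. This is what makes positive
operators, events and channels span. -/
lemma exists_pos_one_add_smul_posSemidef {n : Type} [Fintype n] [DecidableEq n]
    {H : Matrix n n ℂ} (hH : H.IsHermitian) :
    ∃ ε : ℝ, 0 < ε ∧ (1 + (ε : ℂ) • H).PosSemidef := by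
  have h1 : (H + algebraMap ℝ _ ‖H‖).PosSemidef := by
    rw [← Matrix.nonneg_iff_posSemidef]
    have := IsSelfAdjoint.neg_algebraMap_norm_le_self (a := H) hH
    exact neg_le_iff_add_nonneg.1 this
  have hpos : 0 < ‖H‖ + 1 := by positivity
  -- `1 + εH` is `H + ‖H‖ + 1` divided by `‖H‖ + 1`; the extra `1` covers `H = 0`.
  refine ⟨(‖H‖ + 1)⁻¹, inv_pos.2 hpos, ?_⟩
  have h2 : (H + algebraMap ℝ _ ‖H‖ + 1).PosSemidef := h1.add Matrix.PosSemidef.one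
  have h3 : (0 : ℂ) ≤ (((‖H‖ + 1)⁻¹ : ℝ) : ℂ) := by
    exact_mod_cast (inv_pos.2 hpos).le
  have h4 := h2.smul h3
  convert h4 using 1
  have h5 : H + algebraMap ℝ (Matrix n n ℂ) ‖H‖ + 1 = H + ((‖H‖ + 1 : ℝ) : ℂ) • 1 := by
    rw [add_assoc, Algebra.algebraMap_eq_smul_one]
    congr 1
    ext i j
    simp [Matrix.add_apply, add_mul]
  rw [h5, smul_add, smul_smul, ← Complex.ofReal_mul, inv_mul_cancel₀ hpos.ne', Complex.ofReal_one,
    one_smul, add_comm]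

end Loewner

/-- The contraction is `Bᴴ (W ⊗ Mᵀ) B` after reindexing by pairs `(x, c)`, where `B` forgets `c`.
The transpose comes from the index order in `M c' c`. Partial traces and conditional operators are
all instances. -/
lemma posSemidef_contract {ι α γ : Type} [Fintype ι] [Fintype α] [Fintype γ]
    {W : Matrix ι ι ℂ} {M : Matrix γ γ ℂ} (hW : W.PosSemidef) (hM : M.PosSemidef)
    (g : α → γ → ι) :
    (Matrix.of fun x y => ∑ c, ∑ c', W (g x c) (g y c') * M c' c : Matrix α α ℂ).PosSemidef := by
  classical
  have h1 := ((hW.kronecker hM.transpose).submatrix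
    (fun p : α × γ => (g p.1 p.2, p.2))).conjTranspose_mul_mul_same
    (Matrix.of fun (p : α × γ) (x : α) => if p.1 = x then (1 : ℂ) else 0)
  refine Eq.mp (congrArg Matrix.PosSemidef ?_) h1
  ext x y
  simp only [Matrix.mul_apply, Matrix.of_apply, Matrix.conjTranspose_apply, Fintype.sum_prod_type,
    Matrix.submatrix_apply, Matrix.kroneckerMap_apply, Matrix.transpose_apply]
  simp only [apply_ite star, star_one, star_zero, ite_mul, one_mul, zero_mul, mul_ite, mul_one,
    mul_zero]
  rw [Finset.sum_eq_single y (fun b _ hb => by simp [hb]) (by simp)]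
  simp only [if_true]
  rw [Finset.sum_comm (s := Finset.univ) (t := Finset.univ)
    (f := fun c c' => W (g x c) (g y c') * M c' c)]
  refine Finset.sum_congr rfl fun c' _ => ?_
  rw [Finset.sum_eq_single x (fun b _ hb => by simp [hb]) (by simp)]
  simp only [if_true]

lemma posSemidef_sum_diag {ι α γ : Type} [Fintype ι] [Fintype α] [Fintype γ]
    {W : Matrix ι ι ℂ} (hW : W.PosSemidef) (g : α → γ → ι) :
    (Matrix.of fun x y => ∑ c, W (g x c) (g y c) : Matrix α α ℂ).PosSemidef := by
  classical
  simpa [Matrix.one_apply] using posSemidef_contract hW (Matrix.PosSemidef.one (n := γ)) g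

end PosSemidef

/-! ### Linear spans of local operations -/

section Span

variable {X1 X2 : Type} [Fintype X2]

/-- Partial trace over the output system as a linear map. -/
def trOutL : Matrix (X1 × X2) (X1 × X2) ℂ →ₗ[ℂ] Matrix X1 X1 ℂ where
  toFun := trOut
  map_add' M N := by ext; simp [trOut, Finset.sum_add_distrib]
  map_smul' c M := by ext; simp [trOut, Finset.mul_sum]

lemma trOut_add (M N : Matrix (X1 × X2) (X1 × X2) ℂ) : trOut (M + N) = trOut M + trOut N :=
  trOutL.map_add M N

lemma trOut_sub (M N : Matrix (X1 × X2) (X1 × X2) ℂ) : trOut (M - N) = trOut M - trOut N :=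
  trOutL.map_sub M N

lemma trOut_smul (c : ℂ) (M : Matrix (X1 × X2) (X1 × X2) ℂ) : trOut (c • M) = c • trOut M :=
  trOutL.map_smul c M

lemma trOut_conjTranspose (M : Matrix (X1 × X2) (X1 × X2) ℂ) :
    trOut M.conjTranspose = (trOut M).conjTranspose := by
  ext; simp [trOut]

lemma trOut_kronecker (σ : Matrix X1 X1 ℂ) (τ : Matrix X2 X2 ℂ) :
    trOut (σ ⊗ₖ τ) = τ.trace • σ := by
  ext; simp [trOut, Matrix.trace, Finset.mul_sum, mul_comm]

variable [DecidableEq X1] [DecidableEq X2]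

lemma trOut_one : trOut (1 : Matrix (X1 × X2) (X1 × X2) ℂ) = (Fintype.card X2 : ℂ) • 1 := by
  rw [← Matrix.one_kronecker_one, trOut_kronecker, Matrix.trace_one]

variable (X1 X2) in
/-- The Choi operator of the channel with maximally mixed output. -/
def mixed : Matrix (X1 × X2) (X1 × X2) ℂ := (Fintype.card X2 : ℂ)⁻¹ • 1

variable [Fintype X1]

lemma trOut_mixed [Nonempty X2] : trOut (mixed X1 X2) = 1 := by
  rw [mixed, trOut_smul, trOut_one, smul_smul, inv_mul_cancel₀ (by simp), one_smul]

lemma mixed_posSemidef : (mixed X1 X2).PosSemidef :=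
  Matrix.PosSemidef.one.smul (by
    rw [← Complex.ofReal_natCast, ← Complex.ofReal_inv]
    exact_mod_cast inv_nonneg.2 (Nat.cast_nonneg _))

lemma isCPTP_mixed [Nonempty X2] : IsCPTP (mixed X1 X2) :=
  ⟨mixed_posSemidef, trOut_mixed⟩

lemma trOut_posSemidef {M : Matrix (X1 × X2) (X1 × X2) ℂ} (hM : M.PosSemidef) :
    (trOut M).PosSemidef := posSemidef_sum_diag hM fun i k => (i, k)

lemma exists_pos_smul_isEvent {M : Matrix (X1 × X2) (X1 × X2) ℂ} (hM : M.PosSemidef) :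
    ∃ ε : ℝ, 0 < ε ∧ IsEvent ((ε : ℂ) • M) := by
  obtain ⟨ε, hε, h⟩ := exists_pos_one_add_smul_posSemidef (trOut_posSemidef hM).isHermitian.neg
  refine ⟨ε, hε, hM.smul (by exact_mod_cast hε.le), ?_⟩
  rwa [trOut_smul, sub_eq_add_neg, ← smul_neg]

/-- `p` stands for a complex subspace closed under adjoints; `M` is a combination of the Hermitian
elements `M + Mᴴ` and `i (M - Mᴴ)`. -/
lemma linearMap_eq_zero_of_hermitian {n : Type} {f : Matrix n n ℂ →ₗ[ℂ] ℂ}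
    {p : Matrix n n ℂ → Prop} (hadd : ∀ M N, p M → p N → p (M + N))
    (hsmul : ∀ (c : ℂ) M, p M → p (c • M)) (hstar : ∀ M, p M → p M.conjTranspose)
    (h : ∀ M, M.IsHermitian → p M → f M = 0) {M : Matrix n n ℂ} (hM : p M) : f M = 0 := by
  have h1 := h (M + M.conjTranspose) (Matrix.isHermitian_add_transpose_self M)
    (hadd _ _ hM (hstar _ hM))
  have h2 := h (Complex.I • (M + (-1 : ℂ) • M.conjTranspose))
    (by
      ext i j
      simp
      ring)
    (hsmul _ _ (hadd _ _ hM (hsmul _ _ (hstar _ hM))))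
  simp only [map_add, map_smul, smul_eq_mul, mul_eq_zero, Complex.I_ne_zero, false_or] at h1 h2
  linear_combination (h1 + h2) / 2

/-- Positive operators are rescaled events, and a Hermitian `H` is a multiple of the difference of
the positive operators `1 + εH` and `1`. -/
lemma linearMap_eq_zero_of_isEvent {f : Matrix (X1 × X2) (X1 × X2) ℂ →ₗ[ℂ] ℂ}
    (h : ∀ M, IsEvent M → f M = 0) (M : Matrix (X1 × X2) (X1 × X2) ℂ) : f M = 0 := by
  have hpos : ∀ M : Matrix (X1 × X2) (X1 × X2) ℂ, M.PosSemidef → f M = 0 := fun M hM => by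
    obtain ⟨ε, hε, hE⟩ := exists_pos_smul_isEvent hM
    have := h _ hE
    rw [map_smul, smul_eq_mul, mul_eq_zero] at this
    exact this.resolve_left (by exact_mod_cast hε.ne')
  refine linearMap_eq_zero_of_hermitian (p := fun _ => True) (by simp) (by simp) (by simp)
    (fun H hH _ => ?_) trivial
  obtain ⟨ε, hε, hE⟩ := exists_pos_one_add_smul_posSemidef hH
  have h1 := hpos _ hE
  rw [map_add, hpos 1 Matrix.PosSemidef.one, zero_add, map_smul, smul_eq_mul, mul_eq_zero] at h1
  exact h1.resolve_left (by exact_mod_cast hε.ne')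

/-- A Hermitian `D` with zero output trace is a direction along which the maximally mixed channel
stays a channel for small steps, so `f D = 0`. Then `M` is `x` times that channel plus such a `D`.
The case `x = 0` expresses independence of the setting. -/
lemma linearMap_eq_of_isCPTP [Nonempty X2] {f : Matrix (X1 × X2) (X1 × X2) ℂ →ₗ[ℂ] ℂ} {c : ℂ}
    (h : ∀ M, IsCPTP M → f M = c) {M : Matrix (X1 × X2) (X1 × X2) ℂ} {x : ℂ}
    (hM : trOut M = x • 1) : f M = x * c := by
  have h0 : ∀ D : Matrix (X1 × X2) (X1 × X2) ℂ, trOut D = 0 → f D = 0 := fun D hD => by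
    refine linearMap_eq_zero_of_hermitian (p := fun D => trOut D = 0)
      (fun M N hM hN => by rw [trOut_add, hM, hN, add_zero])
      (fun c M hM => by rw [trOut_smul, hM, smul_zero])
      (fun M hM => by rw [trOut_conjTranspose, hM, Matrix.conjTranspose_zero])
      (fun H hH hH0 => ?_) hD
    obtain ⟨ε, hε, hE⟩ := exists_pos_one_add_smul_posSemidef hH
    have hd : (0 : ℂ) ≤ (Fintype.card X2 : ℂ)⁻¹ := by
      rw [← Complex.ofReal_natCast, ← Complex.ofReal_inv]
      exact_mod_cast inv_nonneg.2 (Nat.cast_nonneg _)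
    have h1 := h _ (show IsCPTP ((Fintype.card X2 : ℂ)⁻¹ • (1 + (ε : ℂ) • H)) from
      ⟨hE.smul hd, by
        rw [smul_add, trOut_add, ← mixed, trOut_mixed, trOut_smul, trOut_smul, hH0]; simp⟩)
    rw [smul_add, ← mixed, map_add, h _ isCPTP_mixed] at h1
    simp only [map_smul, smul_eq_mul, add_eq_left, mul_eq_zero, inv_eq_zero] at h1
    simpa [hε.ne'] using h1
  have h1 := h0 (M - x • mixed X1 X2) (by rw [trOut_sub, trOut_smul, trOut_mixed, hM, sub_self])
  rwa [map_sub, map_smul, h _ isCPTP_mixed, sub_eq_zero] at h1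

end Span

/-! ### Bipartite processes: linear characterizations -/

section Bipartite

variable {A1 A2 B1 B2 : Type} [Fintype A1] [DecidableEq A1] [Fintype A2] [DecidableEq A2]
  [Fintype B1] [DecidableEq B1] [Fintype B2] [DecidableEq B2]

/-- Joint probabilities as a bilinear map. -/
def prob₂L (W : Matrix ((A1 × A2) × (B1 × B2)) ((A1 × A2) × (B1 × B2)) ℂ) :
    Matrix (A1 × A2) (A1 × A2) ℂ →ₗ[ℂ] Matrix (B1 × B2) (B1 × B2) ℂ →ₗ[ℂ] ℂ :=
  LinearMap.mk₂ ℂ (prob₂ W)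
    (fun X X' Y => by simp [prob₂, Matrix.add_kronecker, mul_add])
    (fun c X Y => by simp [prob₂, Matrix.smul_kronecker])
    (fun X Y Y' => by simp [prob₂, Matrix.kronecker_add, mul_add])
    (fun c X Y => by simp [prob₂, Matrix.kronecker_smul])

@[simp] lemma prob₂L_apply (W : Matrix ((A1 × A2) × (B1 × B2)) ((A1 × A2) × (B1 × B2)) ℂ)
    (X : Matrix (A1 × A2) (A1 × A2) ℂ) (Y : Matrix (B1 × B2) (B1 × B2) ℂ) :
    prob₂L W X Y = prob₂ W X Y := rfl

lemma prob₂_add (V W : Matrix ((A1 × A2) × (B1 × B2)) ((A1 × A2) × (B1 × B2)) ℂ)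
    (X : Matrix (A1 × A2) (A1 × A2) ℂ) (Y : Matrix (B1 × B2) (B1 × B2) ℂ) :
    prob₂ (V + W) X Y = prob₂ V X Y + prob₂ W X Y := by
  simp [prob₂, add_mul]

lemma prob₂_smul (c : ℂ) (W : Matrix ((A1 × A2) × (B1 × B2)) ((A1 × A2) × (B1 × B2)) ℂ)
    (X : Matrix (A1 × A2) (A1 × A2) ℂ) (Y : Matrix (B1 × B2) (B1 × B2) ℂ) :
    prob₂ (c • W) X Y = c * prob₂ W X Y := by
  simp [prob₂]

lemma prob₂_one_one (W : Matrix ((A1 × A2) × (B1 × B2)) ((A1 × A2) × (B1 × B2)) ℂ) :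
    prob₂ W 1 1 = W.trace := by
  simp [prob₂]

lemma prob₂_swap (W : Matrix ((A1 × A2) × (B1 × B2)) ((A1 × A2) × (B1 × B2)) ℂ)
    (X : Matrix (A1 × A2) (A1 × A2) ℂ) (Y : Matrix (B1 × B2) (B1 × B2) ℂ) :
    prob₂ (W.submatrix Prod.swap Prod.swap) Y X = prob₂ W X Y := by
  simp only [prob₂, Matrix.trace, Matrix.diag, Matrix.mul_apply, Matrix.kroneckerMap_apply,
    Matrix.submatrix_apply]
  rw [← (Equiv.prodComm _ _).sum_comp]
  refine Finset.sum_congr rfl fun p _ => ?_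
  rw [← (Equiv.prodComm _ _).sum_comp]
  refine Finset.sum_congr rfl fun q _ => ?_
  simp [mul_comm]

lemma prob₂_eq_zero_of_noSigAtoB [Nonempty A2]
    {V : Matrix ((A1 × A2) × (B1 × B2)) ((A1 × A2) × (B1 × B2)) ℂ} (hV : NoSigAtoB V)
    {D : Matrix (A1 × A2) (A1 × A2) ℂ} (hD : trOut D = 0) (Y : Matrix (B1 × B2) (B1 × B2) ℂ) :
    prob₂ V D Y = 0 := by
  refine linearMap_eq_zero_of_isEvent (f := prob₂L V D) (fun M hM => ?_) Y
  have := linearMap_eq_of_isCPTP (f := (prob₂L V).flip M) (c := prob₂ V (mixed A1 A2) M)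
    (fun N hN => hV _ _ _ hN isCPTP_mixed hM) (M := D) (x := 0) (by simpa using hD)
  simpa using this

/-- A process without signaling from the first party acts trivially on its output. -/
lemma exists_eq_one_tensor_of_noSigAtoB [Nonempty A2]
    {V : Matrix ((A1 × A2) × (B1 × B2)) ((A1 × A2) × (B1 × B2)) ℂ} (hV : NoSigAtoB V)
    (hpos : V.PosSemidef) :
    ∃ R : Matrix (A1 × (B1 × B2)) (A1 × (B1 × B2)) ℂ, R.PosSemidef ∧
      ∀ x y, V x y = (1 : Matrix A2 A2 ℂ) x.1.2 y.1.2 * R (x.1.1, x.2) (y.1.1, y.2) := by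
  refine ⟨(Fintype.card A2 : ℂ)⁻¹ • Matrix.of fun p q : A1 × (B1 × B2) =>
    ∑ k, V ((p.1, k), p.2) ((q.1, k), q.2), (posSemidef_sum_diag hpos
      fun (p : A1 × (B1 × B2)) k => ((p.1, k), p.2)).smul ?_, ?_⟩
  · rw [← Complex.ofReal_natCast, ← Complex.ofReal_inv]
    exact_mod_cast inv_nonneg.2 (Nat.cast_nonneg _)
  rintro ⟨⟨a, k⟩, b⟩ ⟨⟨a', k'⟩, b'⟩
  -- The second factor is the matrix unit minus its trace part, hence traceless. Pairing `V` with it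
  -- says that an entry of `V` equals `δ_{kk'}` times the average over the diagonal `A2` blocks.
  have key := prob₂_eq_zero_of_noSigAtoB hV
    (D := Matrix.single a' a 1 ⊗ₖ
      (Matrix.single k' k 1 - ((1 : Matrix A2 A2 ℂ) k k' * (Fintype.card A2 : ℂ)⁻¹) • 1))
    (by
      rw [trOut_kronecker]
      by_cases h : k = k'
      · subst h; simp
      · simp [h, Matrix.trace_single_eq_of_ne k' k (1 : ℂ) (Ne.symm h)])
    (Matrix.single b' b 1)
  have hsing : ∀ k k', prob₂ V (Matrix.single a' a 1 ⊗ₖ Matrix.single k' k 1)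
      (Matrix.single b' b 1) = V ((a, k), b) ((a', k'), b') := fun k k' => by
    simp [prob₂, Matrix.single_kronecker_single, Matrix.trace_mul_single]
  have h1 : Matrix.single a' a 1 ⊗ₖ
      (Matrix.single k' k 1 - ((1 : Matrix A2 A2 ℂ) k k' * (Fintype.card A2 : ℂ)⁻¹) • 1) =
      Matrix.single a' a 1 ⊗ₖ Matrix.single k' k 1 -
      ((1 : Matrix A2 A2 ℂ) k k' * (Fintype.card A2 : ℂ)⁻¹) •
        ∑ l, Matrix.single a' a (1 : ℂ) ⊗ₖ Matrix.single l l (1 : ℂ) := by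
    have hone : ∑ l, Matrix.single a' a (1 : ℂ) ⊗ₖ Matrix.single l l (1 : ℂ) =
        Matrix.single a' a (1 : ℂ) ⊗ₖ (1 : Matrix A2 A2 ℂ) := by
      rw [← Matrix.sum_single_one]
      ext p q
      simp [Matrix.sum_apply, Finset.mul_sum]
    rw [hone]
    ext p q
    simp only [Matrix.kroneckerMap_apply, Matrix.sub_apply, Matrix.smul_apply, smul_eq_mul]
    ring
  rw [h1, ← prob₂L_apply, map_sub, map_smul, map_sum] at key
  simp only [LinearMap.sub_apply, LinearMap.smul_apply, LinearMap.sum_apply, prob₂L_apply, hsing,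
    smul_eq_mul] at key
  simp only [Matrix.smul_apply, Matrix.of_apply, smul_eq_mul]
  linear_combination key

lemma exists_eq_tensor_one_of_noSigBtoA [Nonempty B2]
    {V : Matrix ((A1 × A2) × (B1 × B2)) ((A1 × A2) × (B1 × B2)) ℂ} (hV : NoSigBtoA V)
    (hpos : V.PosSemidef) :
    ∃ R : Matrix ((A1 × A2) × B1) ((A1 × A2) × B1) ℂ, R.PosSemidef ∧
      ∀ x y, V x y = (1 : Matrix B2 B2 ℂ) x.2.2 y.2.2 * R (x.1, x.2.1) (y.1, y.2.1) := by
  obtain ⟨R, hR, h⟩ := exists_eq_one_tensor_of_noSigAtoB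
    (V := V.submatrix Prod.swap Prod.swap)
    (fun MA MA' MB h h' hB => by
      rw [prob₂_swap, prob₂_swap]; exact hV _ _ _ hB h h') (hpos.submatrix _)
  exact ⟨R.submatrix Prod.swap Prod.swap, hR.submatrix _, fun x y => h x.swap y.swap⟩

/-- The white-noise process is normalized. -/
lemma prob₂_white [Nonempty A1] [Nonempty B1] {X : Matrix (A1 × A2) (A1 × A2) ℂ}
    {Y : Matrix (B1 × B2) (B1 × B2) ℂ} {x y : ℂ} (hX : trOut X = x • 1) (hY : trOut Y = y • 1) :
    prob₂ (((Fintype.card A1 : ℂ) * (Fintype.card B1 : ℂ))⁻¹ • 1) X Y = x * y := by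
  have htr : ∀ {n m : Type} [Fintype n] [Fintype m] [DecidableEq n]
      {X : Matrix (n × m) (n × m) ℂ} {x : ℂ}, trOut X = x • 1 →
      X.trace = x * Fintype.card n := fun {n m} _ _ _ {X x} h => by
    have : X.trace = (trOut X).trace := by
      simp [Matrix.trace, trOut, Fintype.sum_prod_type]
    rw [this, h]; simp
  rw [prob₂_smul, prob₂, one_mul, Matrix.trace_kronecker, htr hX, htr hY]
  have h1 : (Fintype.card A1 : ℂ) ≠ 0 := by simp
  have h2 : (Fintype.card B1 : ℂ) ≠ 0 := by simp
  field_simp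

lemma isProcMatrix₂_of_prob₂ {W : Matrix ((A1 × A2) × (B1 × B2)) ((A1 × A2) × (B1 × B2)) ℂ}
    (hW : W.PosSemidef) (h : ∀ X Y (x y : ℂ), trOut X = x • 1 → trOut Y = y • 1 →
      prob₂ W X Y = x * y) : IsProcMatrix₂ W :=
  ⟨hW, fun MA MB hA hB => by
    simpa using h MA MB 1 1 (by simpa using hA.2) (by simpa using hB.2)⟩

/-- Inserting the identity for both parties gives `Tr U = d_{A2} d_{B2} c`; positivity of `U` then
decides both the sign of `c` and the case `c = 0`. -/
lemma isProcMatrix₂_normalize [Nonempty A2] [Nonempty B2]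
    {U : Matrix ((A1 × A2) × (B1 × B2)) ((A1 × A2) × (B1 × B2)) ℂ}
    (hU : U.PosSemidef) {c : ℝ} (h : ∀ X Y (x y : ℂ), trOut X = x • 1 → trOut Y = y • 1 →
      prob₂ U X Y = x * y * c) :
    0 ≤ c ∧ (c = 0 → U = 0) ∧ (c ≠ 0 → IsProcMatrix₂ ((c : ℂ)⁻¹ • U)) := by
  have htr : U.trace = (Fintype.card A2 : ℂ) * (Fintype.card B2 : ℂ) * c := by
    rw [← prob₂_one_one, h 1 1 _ _ trOut_one trOut_one]
  have hc : 0 ≤ c := by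
    have h0 := hU.trace_nonneg
    rw [htr] at h0
    have h1 : (0 : ℝ) ≤ (Fintype.card A2 : ℝ) * (Fintype.card B2 : ℝ) * c := by exact_mod_cast h0
    exact nonneg_of_mul_nonneg_right h1 (by positivity)
  refine ⟨hc, fun h0 => ?_, fun h0 => ?_⟩
  · rw [← hU.trace_eq_zero_iff, htr, h0]; simp
  · refine isProcMatrix₂_of_prob₂ (hU.smul ?_) fun X Y x y hX hY => ?_
    · rw [← Complex.ofReal_inv]; exact_mod_cast inv_nonneg.2 hc
    · have : (c : ℂ) ≠ 0 := by exact_mod_cast h0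
      rw [prob₂_smul, h X Y x y hX hY]; field_simp

lemma NoSigAtoB.of_prob₂ {W : Matrix ((A1 × A2) × (B1 × B2)) ((A1 × A2) × (B1 × B2)) ℂ}
    (h : ∀ X Y, trOut X = 0 → prob₂ W X Y = 0) : NoSigAtoB W := fun MA MA' MB hA hA' _ => by
  have := h (MA - MA') MB (by rw [trOut_sub, hA.2, hA'.2, sub_self])
  rwa [← prob₂L_apply, map_sub, LinearMap.sub_apply, sub_eq_zero] at this

lemma NoSigBtoA.of_prob₂ {W : Matrix ((A1 × A2) × (B1 × B2)) ((A1 × A2) × (B1 × B2)) ℂ}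
    (h : ∀ X Y, trOut Y = 0 → prob₂ W X Y = 0) : NoSigBtoA W := fun MA MB MB' _ hB hB' => by
  have := h MA (MB - MB') (by rw [trOut_sub, hB.2, hB'.2, sub_self])
  rwa [← prob₂L_apply, map_sub, sub_eq_zero] at this

/-- White noise signals in neither direction and fills the slot of a component of weight zero, which
cannot be normalized. -/
lemma isProcMatrix₂_white [Nonempty A1] [Nonempty B1] : IsProcMatrix₂
    (((Fintype.card A1 : ℂ) * (Fintype.card B1 : ℂ))⁻¹ •
      (1 : Matrix ((A1 × A2) × (B1 × B2)) ((A1 × A2) × (B1 × B2)) ℂ)) := by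
  refine isProcMatrix₂_of_prob₂ (Matrix.PosSemidef.one.smul ?_) fun X Y x y hX hY =>
    prob₂_white hX hY
  rw [← Complex.ofReal_natCast, ← Complex.ofReal_natCast, ← Complex.ofReal_mul,
    ← Complex.ofReal_inv]
  exact_mod_cast (by positivity)

lemma noSigAtoB_one (c : ℂ) :
    NoSigAtoB (c • (1 : Matrix ((A1 × A2) × (B1 × B2)) ((A1 × A2) × (B1 × B2)) ℂ)) := by
  refine .of_prob₂ fun X Y hX => ?_
  have : X.trace = (trOut X).trace := by simp [Matrix.trace, trOut, Fintype.sum_prod_type]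
  rw [prob₂_smul, prob₂, one_mul, Matrix.trace_kronecker, this, hX]; simp

lemma noSigBtoA_one (c : ℂ) :
    NoSigBtoA (c • (1 : Matrix ((A1 × A2) × (B1 × B2)) ((A1 × A2) × (B1 × B2)) ℂ)) := by
  refine .of_prob₂ fun X Y hY => ?_
  have : Y.trace = (trOut Y).trace := by simp [Matrix.trace, trOut, Fintype.sum_prod_type]
  rw [prob₂_smul, prob₂, one_mul, Matrix.trace_kronecker, this, hY]; simp

/-- A properly normalized sum of two positive operators, the first trivial on the output of Alice
and the second on the output of Bob, is proportional to a causally separable process. -/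
lemma isCausallySeparable₂_of_add [Nonempty A1] [Nonempty A2] [Nonempty B1] [Nonempty B2]
    {U U' : Matrix ((A1 × A2) × (B1 × B2)) ((A1 × A2) × (B1 × B2)) ℂ}
    (hU : U.PosSemidef) (hU' : U'.PosSemidef)
    (h : ∀ X Y, trOut X = 0 → prob₂ U X Y = 0) (h' : ∀ X Y, trOut Y = 0 → prob₂ U' X Y = 0)
    {p : ℂ} (hp : p ≠ 0) (hadd : ∀ X Y (x y : ℂ), trOut X = x • 1 → trOut Y = y • 1 →
      prob₂ (U + U') X Y = x * y * p) :
    IsCausallySeparable₂ (p⁻¹ • (U + U')) := by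
  have hmA : trOut (mixed A1 A2) = (1 : ℂ) • 1 := by rw [trOut_mixed, one_smul]
  have hmB : trOut (mixed B1 B2) = (1 : ℂ) • 1 := by rw [trOut_mixed, one_smul]
  have hAB : ∀ (W : Matrix ((A1 × A2) × (B1 × B2)) ((A1 × A2) × (B1 × B2)) ℂ) X Y (x y : ℂ),
      prob₂ W X Y = x * y * prob₂ W (mixed A1 A2) (mixed B1 B2) +
        x * prob₂ W (mixed A1 A2) (Y - y • mixed B1 B2) + prob₂ W (X - x • mixed A1 A2) Y := by
    intro W X Y x y
    simp only [← prob₂L_apply, map_sub, map_smul, LinearMap.sub_apply, LinearMap.smul_apply,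
      smul_eq_mul]
    ring
  have hX0 : ∀ (X : Matrix (A1 × A2) (A1 × A2) ℂ) (x : ℂ), trOut X = x • 1 →
      trOut (X - x • mixed A1 A2) = 0 := fun X x hX => by
    rw [trOut_sub, trOut_smul, trOut_mixed, hX, sub_self]
  have hY0 : ∀ (X : Matrix (B1 × B2) (B1 × B2) ℂ) (x : ℂ), trOut X = x • 1 →
      trOut (X - x • mixed B1 B2) = 0 := fun X x hX => by
    rw [trOut_sub, trOut_smul, trOut_mixed, hX, sub_self]
  have hreal : ∀ {W : Matrix ((A1 × A2) × (B1 × B2)) ((A1 × A2) × (B1 × B2)) ℂ}, W.PosSemidef →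
      ∃ c : ℝ, prob₂ W (mixed A1 A2) (mixed B1 B2) = c := fun {W} hW => by
    refine ⟨((Fintype.card A2 : ℝ)⁻¹ * (Fintype.card B2 : ℝ)⁻¹) * W.trace.re, ?_⟩
    have htr : W.trace = (W.trace.re : ℂ) :=
      (Complex.eq_re_of_ofReal_le (r := 0) (by simpa using hW.trace_nonneg))
    rw [mixed, mixed, ← prob₂L_apply, map_smul, map_smul, LinearMap.smul_apply, prob₂L_apply,
      prob₂_one_one, htr]
    simp
    ring
  obtain ⟨c, hc⟩ := hreal hU
  obtain ⟨c', hc'⟩ := hreal hU'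
  have hpc : p = (c + c' : ℝ) := by
    have := hadd _ _ 1 1 hmA hmB
    rw [prob₂_add, hc, hc'] at this
    rw [Complex.ofReal_add, this]; ring
  -- `U'` ignores operators of Bob with zero output trace, so there the normalization of the sum is
  -- a condition on `U` alone. Hence `U` is normalized up to `c`, and `U'` by subtraction.
  have hUlin : ∀ X Y (x y : ℂ), trOut X = x • 1 → trOut Y = y • 1 →
      prob₂ U X Y = x * y * c := fun X Y x y hX hY => by
    have h2 := hadd _ _ 1 0 hmA ((hY0 Y y hY).trans (zero_smul _ _).symm)
    rw [prob₂_add, h' _ _ (hY0 Y y hY)] at h2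
    rw [hAB U X Y x y, hc, h _ _ (hX0 X x hX)]
    linear_combination x * h2
  have hUlin' : ∀ X Y (x y : ℂ), trOut X = x • 1 → trOut Y = y • 1 →
      prob₂ U' X Y = x * y * c' := fun X Y x y hX hY => by
    have h2 := hadd X Y x y hX hY
    rw [prob₂_add, hUlin X Y x y hX hY, hpc] at h2
    push_cast at h2
    linear_combination h2
  obtain ⟨hc0, hz, hn⟩ := isProcMatrix₂_normalize hU hUlin
  obtain ⟨hc0', hz', hn'⟩ := isProcMatrix₂_normalize hU' hUlin'
  have hsum : c + c' ≠ 0 := fun h0 => hp (by rw [hpc, h0, Complex.ofReal_zero])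
  have hsumC : (c : ℂ) + c' ≠ 0 := by exact_mod_cast hsum
  have h1c : 1 - c / (c + c') = c' / (c + c') := by field_simp; ring
  obtain ⟨V, hV1, hV2, hV3⟩ : ∃ V, U = (c : ℂ) • V ∧ IsProcMatrix₂ V ∧ NoSigAtoB V := by
    by_cases h0 : c = 0
    · exact ⟨_, by simp [h0, hz h0], isProcMatrix₂_white, noSigAtoB_one _⟩
    · have : (c : ℂ) ≠ 0 := by exact_mod_cast h0
      exact ⟨_, by rw [smul_smul, mul_inv_cancel₀ this, one_smul], hn h0,
        .of_prob₂ fun X Y hX => by rw [prob₂_smul, h X Y hX, mul_zero]⟩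
  obtain ⟨V', hV1', hV2', hV3'⟩ : ∃ V, U' = (c' : ℂ) • V ∧ IsProcMatrix₂ V ∧ NoSigBtoA V := by
    by_cases h0 : c' = 0
    · exact ⟨_, by simp [h0, hz' h0], isProcMatrix₂_white, noSigBtoA_one _⟩
    · have : (c' : ℂ) ≠ 0 := by exact_mod_cast h0
      exact ⟨_, by rw [smul_smul, mul_inv_cancel₀ this, one_smul], hn' h0,
        .of_prob₂ fun X Y hX => by rw [prob₂_smul, h' X Y hX, mul_zero]⟩
  refine ⟨c / (c + c'), V, V', by positivity, div_le_one_of_le₀ (by linarith) (by positivity), ?_,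
    ⟨hV2, hV3⟩, ⟨hV2', hV3'⟩⟩
  rw [h1c, hV1, hV1', hpc]
  ext i j
  simp only [Matrix.smul_apply, Matrix.add_apply, smul_eq_mul, Complex.real_smul]
  push_cast
  field_simp

end Bipartite

/-! ### Product operators of a laboratory -/

section Lab

variable {X1 X2 : Type} [Fintype X1] [DecidableEq X1] [Fintype X2] [DecidableEq X2]

lemma linearMap_eq_zero_of_traceless {X : Type} [Fintype X] [DecidableEq X]
    {f : Matrix X X ℂ →ₗ[ℂ] ℂ} (h : ∀ σ, IsFactor true σ → f σ = 0) {σ : Matrix X X ℂ}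
    (hσ : σ.trace = 0) : f σ = 0 :=
  linearMap_eq_zero_of_hermitian (p := fun σ => σ.trace = 0)
    (fun M N hM hN => by rw [Matrix.trace_add, hM, hN, add_zero])
    (fun c M hM => by rw [Matrix.trace_smul, hM, smul_zero])
    (fun M hM => by rw [Matrix.trace_conjTranspose, hM, star_zero])
    (fun H hH hH0 => h H ⟨hH, fun _ => hH0, by simp⟩) hσ

lemma linearMap_eq_zero_of_isFactor {X : Type} [Fintype X] [DecidableEq X] [Nonempty X]
    {f : Matrix X X ℂ →ₗ[ℂ] ℂ} (h : ∀ t σ, IsFactor t σ → f σ = 0) (σ : Matrix X X ℂ) :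
    f σ = 0 := by
  have h0 : f 1 = 0 := h false 1 ⟨Matrix.isHermitian_one, by simp, by simp⟩
  have h1 : f (σ - (σ.trace * (Fintype.card X : ℂ)⁻¹) • 1) = 0 :=
    linearMap_eq_zero_of_traceless (h true) (by simp)
  rwa [map_sub, map_smul, h0, smul_zero, sub_zero] at h1

lemma eq_sum_single_kronecker (M : Matrix (X1 × X2) (X1 × X2) ℂ) :
    M = ∑ i, ∑ j, Matrix.single i j (1 : ℂ) ⊗ₖ
      (Matrix.of fun k l => M (i, k) (j, l) : Matrix X2 X2 ℂ) := by
  ext ⟨a, k⟩ ⟨b, l⟩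
  simp [Matrix.sum_apply, Matrix.single_apply, ite_and]

lemma linearMap_eq_zero_of_product [Nonempty X1] [Nonempty X2]
    {f : Matrix (X1 × X2) (X1 × X2) ℂ →ₗ[ℂ] ℂ}
    (h : ∀ t t' σ τ, IsFactor t σ → IsFactor t' τ → f (σ ⊗ₖ τ) = 0)
    (M : Matrix (X1 × X2) (X1 × X2) ℂ) : f M = 0 := by
  rw [eq_sum_single_kronecker M]
  simp only [map_sum]
  refine Finset.sum_eq_zero fun i _ => Finset.sum_eq_zero fun j _ => ?_
  refine linearMap_eq_zero_of_isFactor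
    (f := f ∘ₗ Matrix.kroneckerBilinear (R := ℂ) (Matrix.single i j (1 : ℂ)))
    (fun t τ hτ => ?_) _
  exact linearMap_eq_zero_of_isFactor
    (f := f ∘ₗ (Matrix.kroneckerBilinear (R := ℂ)).flip τ)
    (fun t' σ hσ => h t' t σ τ hσ hτ) _

/-- In the expansion of `M` into matrix units on `X1`, the block on `X2` attached to `(i, j)` has
trace `trOut M i j = 0`, so only traceless second factors occur. -/
lemma linearMap_eq_zero_of_trOut_eq_zero [Nonempty X1]
    {f : Matrix (X1 × X2) (X1 × X2) ℂ →ₗ[ℂ] ℂ}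
    (h : ∀ t σ τ, IsFactor t σ → IsFactor true τ → f (σ ⊗ₖ τ) = 0)
    {M : Matrix (X1 × X2) (X1 × X2) ℂ} (hM : trOut M = 0) : f M = 0 := by
  rw [eq_sum_single_kronecker M]
  simp only [map_sum]
  refine Finset.sum_eq_zero fun i _ => Finset.sum_eq_zero fun j _ => ?_
  refine linearMap_eq_zero_of_traceless
    (f := f ∘ₗ Matrix.kroneckerBilinear (R := ℂ) (Matrix.single i j (1 : ℂ))) (fun τ hτ => ?_)
    (congrFun (congrFun hM i) j)
  exact linearMap_eq_zero_of_isFactor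
    (f := f ∘ₗ (Matrix.kroneckerBilinear (R := ℂ)).flip τ)
    (fun t' σ hσ => h t' σ τ hσ hτ) _

lemma linearMap_eq_zero_of_trOut_eq_smul [Nonempty X1] [Nonempty X2]
    {f : Matrix (X1 × X2) (X1 × X2) ℂ →ₗ[ℂ] ℂ} (h1 : f (1 ⊗ₖ 1) = 0)
    (h : ∀ t σ τ, IsFactor t σ → IsFactor true τ → f (σ ⊗ₖ τ) = 0)
    {M : Matrix (X1 × X2) (X1 × X2) ℂ} {x : ℂ} (hM : trOut M = x • 1) : f M = 0 := by
  have h2 := linearMap_eq_zero_of_trOut_eq_zero h (M := M - x • mixed X1 X2)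
    (by rw [trOut_sub, trOut_smul, trOut_mixed, hM, sub_self])
  rw [Matrix.one_kronecker_one] at h1
  rwa [map_sub, map_smul, mixed, map_smul, h1, smul_zero, smul_zero, sub_zero] at h2

end Lab

/-! ### Tripartite processes: linear characterizations -/

section Trace

variable {α β γ : Type} [Fintype α] [Fintype β] [Fintype γ]

lemma sum_comm₂ {δ : Type} [Fintype δ] (f : α → β → γ → δ → ℂ) :
    ∑ a, ∑ b, ∑ c, ∑ d, f a b c d = ∑ c, ∑ d, ∑ a, ∑ b, f a b c d := by
  have := Finset.sum_comm (s := Finset.univ) (t := Finset.univ)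
    (f := fun (p : α × β) (q : γ × δ) => f p.1 p.2 q.1 q.2)
  simpa only [Fintype.sum_prod_type] using this

lemma trace_mul_kronecker₃ (W : Matrix (α × β × γ) (α × β × γ) ℂ) (X : Matrix α α ℂ)
    (Y : Matrix β β ℂ) (Z : Matrix γ γ ℂ) :
    (W * (X ⊗ₖ (Y ⊗ₖ Z))).trace = ∑ a, ∑ b, ∑ c, ∑ a', ∑ b', ∑ c',
      W (a, b, c) (a', b', c') * (X a' a * (Y b' b * Z c' c)) := by
  simp only [Matrix.trace, Matrix.diag, Matrix.mul_apply, Matrix.kroneckerMap_apply,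
    Fintype.sum_prod_type]

lemma trace_mul_kronecker₃_eq_sum_fst (W : Matrix (α × β × γ) (α × β × γ) ℂ) (X : Matrix α α ℂ)
    (Y : Matrix β β ℂ) (Z : Matrix γ γ ℂ) :
    (W * (X ⊗ₖ (Y ⊗ₖ Z))).trace = ∑ a, ∑ a', (∑ r : β × γ, ∑ r' : β × γ,
      W (a, r) (a', r') * (Y r'.1 r.1 * Z r'.2 r.2)) * X a' a := by
  simp only [Matrix.trace, Matrix.diag, Matrix.mul_apply, Matrix.kroneckerMap_apply]
  rw [Fintype.sum_prod_type]
  refine Finset.sum_congr rfl fun a _ => ?_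
  simp only [Fintype.sum_prod_type (α₁ := α)]
  rw [Finset.sum_comm]
  refine Finset.sum_congr rfl fun a' _ => ?_
  simp only [Finset.sum_mul]
  refine Finset.sum_congr rfl fun r _ => Finset.sum_congr rfl fun r' _ => ?_
  ring

lemma trace_mul_kronecker₃_eq_sum_snd (W : Matrix (α × β × γ) (α × β × γ) ℂ) (X : Matrix α α ℂ)
    (Y : Matrix β β ℂ) (Z : Matrix γ γ ℂ) :
    (W * (X ⊗ₖ (Y ⊗ₖ Z))).trace = ∑ b, ∑ b', (∑ r : α × γ, ∑ r' : α × γ,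
      W (r.1, b, r.2) (r'.1, b', r'.2) * (X r'.1 r.1 * Z r'.2 r.2)) * Y b' b := by
  have h := trace_mul_kronecker₃_eq_sum_fst
    (W.submatrix (fun x : β × α × γ => (x.2.1, x.1, x.2.2))
      (fun x : β × α × γ => (x.2.1, x.1, x.2.2))) Y X Z
  simp only [Matrix.submatrix_apply] at h
  rw [← h]
  let e : β × α × γ ≃ α × β × γ :=
    ⟨fun x => (x.2.1, x.1, x.2.2), fun x => (x.2.1, x.1, x.2.2), fun _ => rfl, fun _ => rfl⟩
  simp only [Matrix.trace, Matrix.diag, Matrix.mul_apply, Matrix.kroneckerMap_apply,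
    Matrix.submatrix_apply]
  rw [← e.sum_comp]
  refine Finset.sum_congr rfl fun p _ => ?_
  rw [← e.sum_comp]
  refine Finset.sum_congr rfl fun q _ => ?_
  simp only [e, Equiv.coe_fn_mk]
  ring

end Trace

section Tripartite

variable {A1 A2 B1 B2 C1 C2 : Type}
  [Fintype A1] [DecidableEq A1] [Fintype A2] [DecidableEq A2]
  [Fintype B1] [DecidableEq B1] [Fintype B2] [DecidableEq B2]
  [Fintype C1] [DecidableEq C1] [Fintype C2] [DecidableEq C2]
  {W : Matrix ((A1 × A2) × (B1 × B2) × (C1 × C2)) ((A1 × A2) × (B1 × B2) × (C1 × C2)) ℂ}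

/-- Joint probabilities as a trilinear map. -/
def prob₃L
    (W : Matrix ((A1 × A2) × (B1 × B2) × (C1 × C2)) ((A1 × A2) × (B1 × B2) × (C1 × C2)) ℂ) :
    Matrix (A1 × A2) (A1 × A2) ℂ →ₗ[ℂ] Matrix (B1 × B2) (B1 × B2) ℂ →ₗ[ℂ]
      Matrix (C1 × C2) (C1 × C2) ℂ →ₗ[ℂ] ℂ :=
  LinearMap.mk₂ ℂ
    (fun X Y =>
      { toFun := prob₃ W X Y
        map_add' := fun Z Z' => by simp [prob₃, Matrix.kronecker_add, mul_add]
        map_smul' := fun c Z => by simp [prob₃, Matrix.kronecker_smul] })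
    (fun X X' Y => LinearMap.ext fun Z => by
      change prob₃ W _ _ _ = prob₃ W _ _ _ + prob₃ W _ _ _
      simp [prob₃, Matrix.add_kronecker, mul_add])
    (fun c X Y => LinearMap.ext fun Z => by
      change prob₃ W _ _ _ = c * prob₃ W _ _ _
      simp [prob₃, Matrix.smul_kronecker])
    (fun X Y Y' => LinearMap.ext fun Z => by
      change prob₃ W _ _ _ = prob₃ W _ _ _ + prob₃ W _ _ _
      simp [prob₃, Matrix.kronecker_add, Matrix.add_kronecker, mul_add])
    (fun c X Y => LinearMap.ext fun Z => by
      change prob₃ W _ _ _ = c * prob₃ W _ _ _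
      simp [prob₃, Matrix.kronecker_smul, Matrix.smul_kronecker])

@[simp] lemma prob₃L_apply
    (W : Matrix ((A1 × A2) × (B1 × B2) × (C1 × C2)) ((A1 × A2) × (B1 × B2) × (C1 × C2)) ℂ)
    (X : Matrix (A1 × A2) (A1 × A2) ℂ) (Y : Matrix (B1 × B2) (B1 × B2) ℂ)
    (Z : Matrix (C1 × C2) (C1 × C2) ℂ) : prob₃L W X Y Z = prob₃ W X Y Z := rfl

/-- Normalization on the affine span of local operations. -/
def IsNormalized
    (W : Matrix ((A1 × A2) × (B1 × B2) × (C1 × C2)) ((A1 × A2) × (B1 × B2) × (C1 × C2)) ℂ) :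
    Prop :=
  ∀ X Y Z (x y z : ℂ), trOut X = x • 1 → trOut Y = y • 1 → trOut Z = z • 1 →
    prob₃ W X Y Z = x * y * z

/-- No signaling to the third party, on the linear span of local operations. -/
def IsNoSigLinear
    (W : Matrix ((A1 × A2) × (B1 × B2) × (C1 × C2)) ((A1 × A2) × (B1 × B2) × (C1 × C2)) ℂ) :
    Prop :=
  (∀ X Y Z (y : ℂ), trOut X = 0 → trOut Y = y • 1 → prob₃ W X Y Z = 0) ∧
    ∀ X Y Z (x : ℂ), trOut X = x • 1 → trOut Y = 0 → prob₃ W X Y Z = 0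

/-- Channels are replaced by their linear span one party at a time. -/
lemma isProcMatrix₃_iff [Nonempty A2] [Nonempty B2] [Nonempty C2] :
    IsProcMatrix₃ W ↔ W.PosSemidef ∧ IsNormalized W := by
  refine ⟨fun h => ⟨h.1, fun X Y Z x y z hX hY hZ => ?_⟩, fun h => ⟨h.1, fun MA MB MC hA hB hC => ?_⟩⟩
  · have h1 : ∀ MA MB, IsCPTP MA → IsCPTP MB → prob₃ W MA MB Z = z := fun MA MB hA hB => by
      simpa using linearMap_eq_of_isCPTP (f := prob₃L W MA MB) (c := 1)
        (fun M hM => h.2 MA MB M hA hB hM) hZ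
    have h2 : ∀ MA, IsCPTP MA → prob₃ W MA Y Z = y * z := fun MA hA =>
      linearMap_eq_of_isCPTP (f := (prob₃L W MA).flip Z) (c := z)
        (fun M hM => h1 MA M hA hM) hY
    rw [mul_assoc]
    exact linearMap_eq_of_isCPTP (f := ((prob₃L W).flip Y).flip Z) (c := y * z)
        (fun M hM => h2 M hM) hX
  · simpa using h.2 MA MB MC 1 1 1 (by simpa using hA.2) (by simpa using hB.2) (by simpa using hC.2)

lemma noSigABtoC_iff [Nonempty A2] [Nonempty B2] : NoSigABtoC W ↔ IsNoSigLinear W := by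
  refine ⟨fun h => ⟨fun X Y Z y hX hY => ?_, fun X Y Z x hX hY => ?_⟩,
    fun h MA MA' MB MB' MC hA hA' hB hB' hC => ?_⟩
  · refine linearMap_eq_zero_of_isEvent (f := prob₃L W X Y) (fun M hM => ?_) Z
    have h1 : ∀ MB, IsCPTP MB → prob₃ W X MB M = 0 := fun MB hB => by
      simpa using linearMap_eq_of_isCPTP (f := ((prob₃L W).flip MB).flip M)
        (c := prob₃ W (mixed A1 A2) MB M) (x := 0)
        (fun N hN => h _ _ _ _ _ hN isCPTP_mixed hB hB hM) (by simpa using hX)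
    simpa using linearMap_eq_of_isCPTP (f := (prob₃L W X).flip M) (c := 0) h1 hY
  · refine linearMap_eq_zero_of_isEvent (f := prob₃L W X Y) (fun M hM => ?_) Z
    have h1 : ∀ MA, IsCPTP MA → prob₃ W MA Y M = 0 := fun MA hA => by
      simpa using linearMap_eq_of_isCPTP (f := (prob₃L W MA).flip M)
        (c := prob₃ W MA (mixed B1 B2) M) (x := 0)
        (fun N hN => h _ _ _ _ _ hA hA hN isCPTP_mixed hM) (by simpa using hY)
    simpa using linearMap_eq_of_isCPTP (f := ((prob₃L W).flip Y).flip M) (c := 0) h1 hX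
  -- The two settings are changed one after the other, through the intermediate pair `(MA', MB)`.
  · have h1 := h.1 (MA - MA') MB MC 1 (by rw [trOut_sub, hA.2, hA'.2, sub_self])
      (by simpa using hB.2)
    have h2 := h.2 MA' (MB - MB') MC 1 (by simpa using hA'.2)
      (by rw [trOut_sub, hB.2, hB'.2, sub_self])
    simp only [← prob₃L_apply, map_sub, LinearMap.sub_apply] at h1 h2 ⊢
    linear_combination h1 + h2

/-- In a forbidden term the factors of Alice and Bob have output trace proportional to the identity,
and it vanishes when the output factor is nontrivial; no signaling then kills the term. If both
output factors are trivial, both laboratories carry the identity and `C2` must be nontrivial, so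
normalization kills the term. -/
lemma IsNoSigLinear.onlyCFirstTerms (h : IsNoSigLinear W) (hn : IsNormalized W) :
    OnlyCFirstTerms W := by
  intro a₁ a₂ b₁ b₂ c₁ c₂ hnot σA1 σA2 σB1 σB2 σC1 σC2 hA1 hA2 hB1 hB2 hC1 hC2
  have htr : ∀ {X1 X2 : Type} [Fintype X1] [DecidableEq X1] [Fintype X2] [DecidableEq X2]
      {t t' : Bool} {σ : Matrix X1 X1 ℂ} {τ : Matrix X2 X2 ℂ}, IsFactor t σ → IsFactor t' τ →
      ¬ (t = true ∧ t' = false) →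
      (t' = true → trOut (σ ⊗ₖ τ) = 0) ∧ ∃ c : ℂ, trOut (σ ⊗ₖ τ) = c • 1 := by
    intro X1 X2 _ _ _ _ t t' σ τ hσ hτ hn
    rw [trOut_kronecker]
    cases t'
    · cases t
      · exact ⟨by simp, _, by rw [hσ.2.2 rfl]⟩
      · simp at hn
    · rw [hτ.2.1 rfl]
      exact ⟨by simp, 0, by simp⟩
  simp only [AllowedCFirst, not_or] at hnot
  obtain ⟨hnA, hnB, hnC⟩ := hnot
  obtain ⟨hA0, x, hx⟩ := htr hA1 hA2 hnA
  obtain ⟨hB0, y, hy⟩ := htr hB1 hB2 hnB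
  change prob₃ W (σA1 ⊗ₖ σA2) (σB1 ⊗ₖ σB2) (σC1 ⊗ₖ σC2) = 0
  cases a₂
  · cases b₂
    · have hc : c₂ = true := by cases a₁ <;> cases b₁ <;> cases c₂ <;> simp_all
      subst hc
      rw [hn _ _ _ x y 0 hx hy (by rw [trOut_kronecker, hC2.2.1 rfl, zero_smul, zero_smul]),
        mul_zero]
    · exact h.2 _ _ _ x hx (hB0 rfl)
  · exact h.1 _ _ _ y (hA0 rfl) hy

lemma isFactor_one {X : Type} [Fintype X] [DecidableEq X] :
    IsFactor false (1 : Matrix X X ℂ) :=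
  ⟨Matrix.isHermitian_one, by simp, by simp⟩

/-- An operator of one party with zero output trace expands into products with nontrivial output,
and one of the other party with output trace proportional to the identity into `1 ⊗ 1` and such
products. None of the resulting types is allowed, whatever Charlie's factors. -/
lemma OnlyCFirstTerms.isNoSigLinear [Nonempty A1] [Nonempty A2] [Nonempty B1] [Nonempty B2]
    [Nonempty C1] [Nonempty C2] (h : OnlyCFirstTerms W) : IsNoSigLinear W := by
  constructor
  · intro X Y Z y hX hY
    refine linearMap_eq_zero_of_trOut_eq_zero (f := ((prob₃L W).flip Y).flip Z)
      (fun a₁ σA1 σA2 hA1 hA2 => ?_) hX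
    have hC : ∀ b₁ b₂ σB1 σB2, IsFactor b₁ σB1 → IsFactor b₂ σB2 → (b₁ = true → b₂ = true) →
        prob₃ W (σA1 ⊗ₖ σA2) (σB1 ⊗ₖ σB2) Z = 0 := fun b₁ b₂ σB1 σB2 hB1 hB2 hb =>
      linearMap_eq_zero_of_product (f := prob₃L W (σA1 ⊗ₖ σA2) (σB1 ⊗ₖ σB2))
        (fun c₁ c₂ σC1 σC2 hC1 hC2 => h a₁ true b₁ b₂ c₁ c₂
          (by cases b₁ <;> cases b₂ <;> simp_all [AllowedCFirst]) _ _ _ _ _ _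
          hA1 hA2 hB1 hB2 hC1 hC2) Z
    exact linearMap_eq_zero_of_trOut_eq_smul (f := (prob₃L W (σA1 ⊗ₖ σA2)).flip Z)
      (hC false false 1 1 isFactor_one isFactor_one (by simp))
      (fun b₁ σB1 σB2 hB1 hB2 => hC b₁ true σB1 σB2 hB1 hB2 (by simp)) hY
  · intro X Y Z y hX hY
    refine linearMap_eq_zero_of_trOut_eq_zero (f := (prob₃L W X).flip Z)
      (fun a₁ σB1 σB2 hA1 hA2 => ?_) hY
    have hC : ∀ b₁ b₂ σA1 σA2, IsFactor b₁ σA1 → IsFactor b₂ σA2 → (b₁ = true → b₂ = true) →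
        prob₃ W (σA1 ⊗ₖ σA2) (σB1 ⊗ₖ σB2) Z = 0 := fun b₁ b₂ σA1 σA2 hB1 hB2 hb =>
      linearMap_eq_zero_of_product (f := prob₃L W (σA1 ⊗ₖ σA2) (σB1 ⊗ₖ σB2))
        (fun c₁ c₂ σC1 σC2 hC1 hC2 => h b₁ b₂ a₁ true c₁ c₂
          (by cases b₁ <;> cases b₂ <;> simp_all [AllowedCFirst]) _ _ _ _ _ _
          hB1 hB2 hA1 hA2 hC1 hC2) Z
    exact linearMap_eq_zero_of_trOut_eq_smul (f := ((prob₃L W).flip (σB1 ⊗ₖ σB2)).flip Z)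
      (hC false false 1 1 isFactor_one isFactor_one (by simp))
      (fun b₁ σA1 σA2 hB1 hB2 => hC b₁ true σA1 σA2 hB1 hB2 (by simp)) hX

/-! ### Conditional processes -/

lemma prob₂_traceC
    (W : Matrix ((A1 × A2) × (B1 × B2) × (C1 × C2)) ((A1 × A2) × (B1 × B2) × (C1 × C2)) ℂ)
    (X : Matrix (A1 × A2) (A1 × A2) ℂ) (Y : Matrix (B1 × B2) (B1 × B2) ℂ)
    (Z : Matrix (C1 × C2) (C1 × C2) ℂ) : prob₂ (traceC W Z) X Y = prob₃ W X Y Z := by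
  rw [prob₃, trace_mul_kronecker₃]
  have h2 : ∀ {α β : Type} [Fintype α] [Fintype β] (V : Matrix (α × β) (α × β) ℂ)
      (X : Matrix α α ℂ) (Y : Matrix β β ℂ), (V * (X ⊗ₖ Y)).trace = ∑ a, ∑ b, ∑ a', ∑ b',
        V (a, b) (a', b') * (X a' a * Y b' b) := fun V X Y => by
    simp only [Matrix.trace, Matrix.diag, Matrix.mul_apply, Matrix.kroneckerMap_apply,
      Fintype.sum_prod_type]
  rw [prob₂, h2]
  refine Finset.sum_congr rfl fun a _ => Finset.sum_congr rfl fun b _ => ?_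
  rw [Finset.sum_comm (s := (Finset.univ : Finset (C1 × C2)))]
  refine Finset.sum_congr rfl fun a' _ => ?_
  rw [Finset.sum_comm (s := (Finset.univ : Finset (C1 × C2)))]
  refine Finset.sum_congr rfl fun b' _ => ?_
  simp only [traceC, Matrix.of_apply, Finset.sum_mul]
  refine Finset.sum_congr rfl fun c _ => Finset.sum_congr rfl fun c' _ => ?_
  ring

lemma trace_traceC
    (W : Matrix ((A1 × A2) × (B1 × B2) × (C1 × C2)) ((A1 × A2) × (B1 × B2) × (C1 × C2)) ℂ)
    (M : Matrix (C1 × C2) (C1 × C2) ℂ) :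
    ((Fintype.card A2 : ℂ) * (Fintype.card B2 : ℂ))⁻¹ * (traceC W M).trace = probC W M := by
  have h2 : (traceC W M).trace = ∑ a, ∑ b, ∑ c, ∑ c', W (a, b, c) (a, b, c') * M c' c := by
    rw [Matrix.trace, Fintype.sum_prod_type]; rfl
  rw [h2, probC, reducedC, Matrix.smul_mul, Matrix.trace_smul, smul_eq_mul]
  congr 1
  simp only [Matrix.trace, Matrix.diag, Matrix.mul_apply, Matrix.of_apply, Finset.sum_mul]
  exact (sum_comm₂ _).symm

/-- No signaling allows `X` and `Y` to be replaced by `x` and `y` times the maximally mixed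
channels, for which the probability is Charlie's reduced one. This normalizes the conditional
processes. -/
lemma IsNoSigLinear.prob₃_eq [Nonempty A2] [Nonempty B2] (h : IsNoSigLinear W)
    {X : Matrix (A1 × A2) (A1 × A2) ℂ} {Y : Matrix (B1 × B2) (B1 × B2) ℂ} {x y : ℂ}
    (hX : trOut X = x • 1) (hY : trOut Y = y • 1) (Z : Matrix (C1 × C2) (C1 × C2) ℂ) :
    prob₃ W X Y Z = x * y * probC W Z := by
  have h1 := h.1 (X - x • mixed A1 A2) Y Z y
    (by rw [trOut_sub, trOut_smul, trOut_mixed, hX, sub_self]) hY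
  have h2 := h.2 (mixed A1 A2) (Y - y • mixed B1 B2) Z 1 (by rw [trOut_mixed, one_smul])
    (by rw [trOut_sub, trOut_smul, trOut_mixed, hY, sub_self])
  have h3 : prob₃ W (mixed A1 A2) (mixed B1 B2) Z = probC W Z := by
    rw [← trace_traceC, ← prob₂_one_one, prob₂_traceC, mixed, mixed]
    simp only [← prob₃L_apply, map_smul, LinearMap.smul_apply, smul_eq_mul, mul_inv]
    ring
  simp only [← prob₃L_apply, map_sub, LinearMap.sub_apply, map_smul, LinearMap.smul_apply,
    smul_eq_mul] at h1 h2 h3 ⊢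
  linear_combination h1 + x * h2 + x * y * h3

lemma traceC_posSemidef (hW : W.PosSemidef) {M : Matrix (C1 × C2) (C1 × C2) ℂ}
    (hM : M.PosSemidef) : (traceC W M).PosSemidef :=
  posSemidef_contract hW hM fun (x : (A1 × A2) × (B1 × B2)) c => (x.1, x.2, c)

lemma traceC_add
    (V W : Matrix ((A1 × A2) × (B1 × B2) × (C1 × C2)) ((A1 × A2) × (B1 × B2) × (C1 × C2)) ℂ)
    (M : Matrix (C1 × C2) (C1 × C2) ℂ) : traceC (V + W) M = traceC V M + traceC W M := by
  ext
  simp [traceC, add_mul, Finset.sum_add_distrib]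

/-- The identity on `A2` makes the trace depend on `X` only through `trOut X`. -/
lemma prob₃_idA2 (V : Matrix (A1 × (B1 × B2) × (C1 × C2)) (A1 × (B1 × B2) × (C1 × C2)) ℂ)
    {X : Matrix (A1 × A2) (A1 × A2) ℂ} (hX : trOut X = 0) (Y : Matrix (B1 × B2) (B1 × B2) ℂ)
    (Z : Matrix (C1 × C2) (C1 × C2) ℂ) : prob₃ (idA2 V) X Y Z = 0 := by
  rw [prob₃, trace_mul_kronecker₃_eq_sum_fst, Fintype.sum_prod_type]
  refine Finset.sum_eq_zero fun a _ => ?_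
  simp only [Fintype.sum_prod_type (α₁ := A1) (α₂ := A2)]
  rw [Finset.sum_comm]
  refine Finset.sum_eq_zero fun a' _ => ?_
  have h0 := congrFun (congrFun hX a') a
  simp only [trOut, Matrix.of_apply, Matrix.zero_apply] at h0
  have h1 : ∀ k k' : A2, ∑ r : (B1 × B2) × (C1 × C2), ∑ r' : (B1 × B2) × (C1 × C2), idA2 V ((a, k), r) ((a', k'), r') * (Y r'.1 r.1 * Z r'.2 r.2) =
      if k = k' then ∑ r : (B1 × B2) × (C1 × C2), ∑ r' : (B1 × B2) × (C1 × C2), V (a, r) (a', r') * (Y r'.1 r.1 * Z r'.2 r.2) else 0 := fun k k' => by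
    by_cases h : k = k' <;> simp [idA2, h]
  simp only [h1, ite_mul, zero_mul, Finset.sum_ite_eq, Finset.mem_univ, if_true, ← Finset.mul_sum]
  rw [h0, mul_zero]

lemma prob₃_idB2 (V : Matrix ((A1 × A2) × B1 × (C1 × C2)) ((A1 × A2) × B1 × (C1 × C2)) ℂ)
    (X : Matrix (A1 × A2) (A1 × A2) ℂ) {Y : Matrix (B1 × B2) (B1 × B2) ℂ} (hY : trOut Y = 0)
    (Z : Matrix (C1 × C2) (C1 × C2) ℂ) : prob₃ (idB2 V) X Y Z = 0 := by
  rw [prob₃, trace_mul_kronecker₃_eq_sum_snd, Fintype.sum_prod_type]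
  refine Finset.sum_eq_zero fun a _ => ?_
  simp only [Fintype.sum_prod_type (α₁ := B1) (α₂ := B2)]
  rw [Finset.sum_comm]
  refine Finset.sum_eq_zero fun a' _ => ?_
  have h0 := congrFun (congrFun hY a') a
  simp only [trOut, Matrix.of_apply, Matrix.zero_apply] at h0
  have h1 : ∀ k k' : B2, ∑ r : (A1 × A2) × (C1 × C2), ∑ r' : (A1 × A2) × (C1 × C2), idB2 V (r.1, (a, k), r.2) (r'.1, (a', k'), r'.2) * (X r'.1 r.1 * Z r'.2 r.2) =
      if k = k' then ∑ r : (A1 × A2) × (C1 × C2), ∑ r' : (A1 × A2) × (C1 × C2), V (r.1, a, r.2) (r'.1, a', r'.2) * (X r'.1 r.1 * Z r'.2 r.2) else 0 := fun k k' => by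
    by_cases h : k = k' <;> simp [idB2, h]
  simp only [h1, ite_mul, zero_mul, Finset.sum_ite_eq, Finset.mem_univ, if_true, ← Finset.mul_sum]
  rw [h0, mul_zero]

lemma idA2_posSemidef {V : Matrix (A1 × (B1 × B2) × (C1 × C2)) (A1 × (B1 × B2) × (C1 × C2)) ℂ}
    (hV : V.PosSemidef) : (idA2 (A2 := A2) V).PosSemidef :=
  ((Matrix.PosSemidef.one (n := A2)).kronecker hV).submatrix
    fun x : (A1 × A2) × (B1 × B2) × (C1 × C2) => (x.1.2, x.1.1, x.2.1, x.2.2)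

lemma idB2_posSemidef {V : Matrix ((A1 × A2) × B1 × (C1 × C2)) ((A1 × A2) × B1 × (C1 × C2)) ℂ}
    (hV : V.PosSemidef) : (idB2 (B2 := B2) V).PosSemidef :=
  ((Matrix.PosSemidef.one (n := B2)).kronecker hV).submatrix
    fun x : (A1 × A2) × (B1 × B2) × (C1 × C2) => (x.2.1.2, x.1, x.2.1.1, x.2.2)

/-- Processes in canonical form are causally separable with the third party first. -/
lemma HasLastFirstForm.isCausallySeparableLastFirst [Nonempty A1] [Nonempty A2] [Nonempty B1]
    [Nonempty B2] [Nonempty C1] [Nonempty C2] (h : HasLastFirstForm W) :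
    IsCausallySeparableLastFirst W := by
  obtain ⟨hproc, hterms, V, V', hV, hV', rfl⟩ := h
  have hns := hterms.isNoSigLinear
  refine ⟨hproc, noSigABtoC_iff.2 hns, fun M hM hp => ?_⟩
  rw [condAB, traceC_add]
  refine isCausallySeparable₂_of_add (traceC_posSemidef (idA2_posSemidef hV) hM.1)
    (traceC_posSemidef (idB2_posSemidef hV') hM.1)
    (fun X Y hX => by rw [prob₂_traceC, prob₃_idA2 V hX])
    (fun X Y hX => by rw [prob₂_traceC, prob₃_idB2 V' X hX]) hp (fun X Y x y hX hY => ?_)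
  rw [← traceC_add, prob₂_traceC, hns.prob₃_eq hX hY]

end Tripartite

/-! ### Relabelings -/

section Relabel

variable {α β γ : Type}

lemma toACB_posSemidef_iff {W : Matrix (α × β × γ) (α × β × γ) ℂ} :
    (toACB W).PosSemidef ↔ W.PosSemidef :=
  ⟨fun h => h.submatrix (fun x : α × β × γ => (x.1, x.2.2, x.2.1)), fun h => h.submatrix _⟩

lemma toBCA_posSemidef_iff {W : Matrix (α × β × γ) (α × β × γ) ℂ} :
    (toBCA W).PosSemidef ↔ W.PosSemidef :=
  ⟨fun h => h.submatrix (fun x : α × β × γ => (x.2.1, x.2.2, x.1)), fun h => h.submatrix _⟩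

variable [Fintype α] [Fintype β] [Fintype γ]

lemma trace_toACB (W : Matrix (α × β × γ) (α × β × γ) ℂ) : (toACB W).trace = W.trace :=
  Equiv.sum_comp (⟨fun x => (x.1, x.2.2, x.2.1), fun x => (x.1, x.2.2, x.2.1), fun _ => rfl,
    fun _ => rfl⟩ : α × γ × β ≃ α × β × γ) fun x => W x x

lemma trace_toBCA (W : Matrix (α × β × γ) (α × β × γ) ℂ) : (toBCA W).trace = W.trace :=
  Equiv.sum_comp (⟨fun x => (x.2.2, x.1, x.2.1), fun x => (x.2.1, x.2.2, x.1), fun _ => rfl,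
    fun _ => rfl⟩ : β × γ × α ≃ α × β × γ) fun x => W x x

end Relabel

section Extension

variable {A1 A2 B1 B2 C1 C2 : Type}
  [Fintype A1] [DecidableEq A1] [Fintype A2] [DecidableEq A2]
  [Fintype B1] [DecidableEq B1] [Fintype B2] [DecidableEq B2]
  [Fintype C1] [DecidableEq C1] [Fintype C2] [DecidableEq C2]
  {A' B' C' : Type} [Fintype A'] [DecidableEq A'] [Fintype B'] [DecidableEq B']
  [Fintype C'] [DecidableEq C']
  {W : Matrix ((A1 × A2) × (B1 × B2) × (C1 × C2)) ((A1 × A2) × (B1 × B2) × (C1 × C2)) ℂ}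
  {ρ : Matrix (A' × B' × C') (A' × B' × C') ℂ}

/-! ### Extension by input ancillas -/

variable (A1 A2 B1 B2 C1 C2 A' B' C') in
/-- Regrouping of an extended process: original systems first, ancillas last. -/
def extendEquiv : ((A1 × A2) × (B1 × B2) × (C1 × C2)) × (A' × B' × C') ≃
    ((A1 × A') × A2) × ((B1 × B') × B2) × ((C1 × C') × C2) where
  toFun p := (((p.1.1.1, p.2.1), p.1.1.2), ((p.1.2.1.1, p.2.2.1), p.1.2.1.2),
    ((p.1.2.2.1, p.2.2.2), p.1.2.2.2))
  invFun x := (((x.1.1.1, x.1.2), (x.2.1.1.1, x.2.1.2), (x.2.2.1.1, x.2.2.2)),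
    (x.1.1.2, x.2.1.1.2, x.2.2.1.2))
  left_inv _ := rfl
  right_inv _ := rfl

lemma extend_submatrix_extendEquiv :
    (extend W ρ).submatrix (extendEquiv A1 A2 B1 B2 C1 C2 A' B' C')
      (extendEquiv A1 A2 B1 B2 C1 C2 A' B' C') = W ⊗ₖ ρ := rfl

lemma extend_posSemidef (hW : W.PosSemidef) (hρ : ρ.PosSemidef) : (extend W ρ).PosSemidef :=
  (hW.kronecker hρ).submatrix (extendEquiv A1 A2 B1 B2 C1 C2 A' B' C').symm

/-- The block of an operator on an extended laboratory for given ancilla indices. -/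
def ancillaBlock {X1 X2 X' : Type} (M : Matrix ((X1 × X') × X2) ((X1 × X') × X2) ℂ) (i j : X') :
    Matrix (X1 × X2) (X1 × X2) ℂ :=
  Matrix.of fun p q => M ((p.1, i), p.2) ((q.1, j), q.2)

lemma trOut_ancillaBlock {X1 X2 X' : Type} [Fintype X2] [DecidableEq X1] [DecidableEq X']
    {M : Matrix ((X1 × X') × X2) ((X1 × X') × X2) ℂ} {x : ℂ} (hM : trOut M = x • 1) (i j : X') :
    trOut (ancillaBlock M i j) = (x * (1 : Matrix X' X' ℂ) i j) • 1 := by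
  ext a b
  have := congrFun (congrFun hM (a, i)) (b, j)
  simp only [trOut, Matrix.of_apply, Matrix.smul_apply, smul_eq_mul, Matrix.one_apply,
    Prod.mk.injEq] at this
  simp only [trOut, ancillaBlock, Matrix.of_apply, this, Matrix.smul_apply, smul_eq_mul,
    Matrix.one_apply]
  by_cases h1 : a = b <;> by_cases h2 : i = j <;> simp [h1, h2]

lemma prob₃_extend (X : Matrix ((A1 × A') × A2) ((A1 × A') × A2) ℂ)
    (Y : Matrix ((B1 × B') × B2) ((B1 × B') × B2) ℂ)
    (Z : Matrix ((C1 × C') × C2) ((C1 × C') × C2) ℂ) :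
    prob₃ (extend W ρ) X Y Z = ∑ u, ∑ v, ρ u v * prob₃ W (ancillaBlock X v.1 u.1)
      (ancillaBlock Y v.2.1 u.2.1) (ancillaBlock Z v.2.2 u.2.2) := by
  simp only [prob₃, Matrix.trace, Matrix.diag, Matrix.mul_apply, Matrix.kroneckerMap_apply]
  rw [← (extendEquiv A1 A2 B1 B2 C1 C2 A' B' C').sum_comp]
  simp only [← (extendEquiv A1 A2 B1 B2 C1 C2 A' B' C').sum_comp (fun x => extend W ρ _ x * _)]
  rw [Fintype.sum_prod_type, Finset.sum_comm]
  refine Finset.sum_congr rfl fun u _ => ?_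
  simp only [Finset.mul_sum]
  rw [Finset.sum_comm (s := (Finset.univ : Finset (A' × B' × C')))]
  refine Finset.sum_congr rfl fun p _ => ?_
  rw [Fintype.sum_prod_type, Finset.sum_comm]
  refine Finset.sum_congr rfl fun v _ => Finset.sum_congr rfl fun q _ => ?_
  simp only [extend, extendEquiv, ancillaBlock, Equiv.coe_fn_mk, Matrix.of_apply]
  ring

/-- Off-diagonal ancilla blocks have zero output trace and drop out; the diagonal ones are weighted
by the diagonal of `ρ`, which sums to one. -/
lemma IsNormalized.extend (h : IsNormalized W) (hρ : ρ.trace = 1) :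
    IsNormalized (extend W ρ) := fun X Y Z x y z hX hY hZ => by
  rw [prob₃_extend]
  simp only [h _ _ _ _ _ _ (trOut_ancillaBlock hX _ _) (trOut_ancillaBlock hY _ _)
    (trOut_ancillaBlock hZ _ _)]
  rw [← mul_one (x * y * z), ← hρ, Matrix.trace, Finset.mul_sum]
  refine Finset.sum_congr rfl fun u _ => ?_
  rw [Finset.sum_eq_single u]
  · simp; ring
  · rintro ⟨i, j, k⟩ _ hv
    obtain ⟨i', j', k'⟩ := u
    simp only [ne_eq, Prod.mk.injEq, not_and] at hv
    by_cases h1 : i = i' <;> by_cases h2 : j = j' <;> simp_all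
  · simp

lemma IsNoSigLinear.extend (h : IsNoSigLinear W) : IsNoSigLinear (extend W ρ) := by
  have h0 : ∀ {X1 X2 X' : Type} [Fintype X2] [DecidableEq X1] [DecidableEq X']
      {M : Matrix ((X1 × X') × X2) ((X1 × X') × X2) ℂ}, trOut M = 0 → ∀ i j,
      trOut (ancillaBlock M i j) = 0 := fun {X1 X2 X'} _ _ _ {M} hM i j => by
    simpa using trOut_ancillaBlock (x := 0) (hM.trans (zero_smul ℂ _).symm) i j
  constructor
  · intro X Y Z y hX hY
    rw [prob₃_extend]
    refine Finset.sum_eq_zero fun u _ => Finset.sum_eq_zero fun v _ => ?_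
    rw [h.1 _ _ _ _ (h0 hX _ _) (trOut_ancillaBlock hY _ _), mul_zero]
  · intro X Y Z x hX hY
    rw [prob₃_extend]
    refine Finset.sum_eq_zero fun u _ => Finset.sum_eq_zero fun v _ => ?_
    rw [h.2 _ _ _ _ (trOut_ancillaBlock hX _ _) (h0 hY _ _), mul_zero]

/-- The condition on terms is carried over through no signaling and normalization instead of term by
term. The ancillas are inputs, so `ρ` is absorbed into `V` and `V'`. -/
lemma HasLastFirstForm.extend [Nonempty A1] [Nonempty A2] [Nonempty B1] [Nonempty B2]
    [Nonempty C1] [Nonempty C2] (h : HasLastFirstForm W) (hρ : ρ.PosSemidef)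
    (htr : ρ.trace = 1) : HasLastFirstForm (extend W ρ) := by
  obtain ⟨hproc, hterms, V, V', hV, hV', hW⟩ := h
  obtain ⟨hpos, hnorm⟩ := isProcMatrix₃_iff.1 hproc
  have hn := hnorm.extend htr
  refine ⟨isProcMatrix₃_iff.2 ⟨extend_posSemidef hpos hρ, hn⟩,
    hterms.isNoSigLinear.extend.onlyCFirstTerms hn, ?_⟩
  refine ⟨(V ⊗ₖ ρ).submatrix
    (fun x : (A1 × A') × ((B1 × B') × B2) × ((C1 × C') × C2) =>
      ((x.1.1, (x.2.1.1.1, x.2.1.2), (x.2.2.1.1, x.2.2.2)), (x.1.2, x.2.1.1.2, x.2.2.1.2)))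
    (fun x : (A1 × A') × ((B1 × B') × B2) × ((C1 × C') × C2) =>
      ((x.1.1, (x.2.1.1.1, x.2.1.2), (x.2.2.1.1, x.2.2.2)), (x.1.2, x.2.1.1.2, x.2.2.1.2))),
    (V' ⊗ₖ ρ).submatrix
    (fun x : ((A1 × A') × A2) × (B1 × B') × ((C1 × C') × C2) =>
      (((x.1.1.1, x.1.2), x.2.1.1, (x.2.2.1.1, x.2.2.2)), (x.1.1.2, x.2.1.2, x.2.2.1.2)))
    (fun x : ((A1 × A') × A2) × (B1 × B') × ((C1 × C') × C2) =>
      (((x.1.1.1, x.1.2), x.2.1.1, (x.2.2.1.1, x.2.2.2)), (x.1.1.2, x.2.1.2, x.2.2.1.2))),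
    (hV.kronecker hρ).submatrix _, (hV'.kronecker hρ).submatrix _, ?_⟩
  ext x y
  simp only [hW, ProcMat.extend, idA2, idB2, Matrix.of_apply, Matrix.add_apply,
    Matrix.submatrix_apply, Matrix.kroneckerMap_apply]
  ring

lemma toACB_extend : toACB (extend W ρ) = extend (toACB W) (toACB ρ) := rfl

lemma toBCA_extend : toBCA (extend W ρ) = extend (toBCA W) (toBCA ρ) := rfl

/-! ### Sufficiency of the canonical form -/

/-- Convex combinations of processes in canonical form are extensibly causally separable. -/
lemma isECS_of_hasLastFirstForm [Nonempty A1] [Nonempty A2] [Nonempty B1] [Nonempty B2]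
    [Nonempty C1] [Nonempty C2] {q₁ q₂ q₃ : ℝ}
    {W₁ W₂ W₃ :
      Matrix ((A1 × A2) × (B1 × B2) × (C1 × C2)) ((A1 × A2) × (B1 × B2) × (C1 × C2)) ℂ}
    (h₁ : 0 ≤ q₁) (h₂ : 0 ≤ q₂) (h₃ : 0 ≤ q₃) (hq : q₁ + q₂ + q₃ = 1)
    (hW : W = q₁ • W₁ + q₂ • W₂ + q₃ • W₃) (hf₁ : HasLastFirstForm W₁)
    (hf₂ : HasLastFirstForm (toACB W₂)) (hf₃ : HasLastFirstForm (toBCA W₃)) : IsECS W := by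
  refine ⟨⟨q₁, q₂, q₃, W₁, W₂, W₃, h₁, h₂, h₃, hq, hW, hf₁.isCausallySeparableLastFirst,
    hf₂.isCausallySeparableLastFirst, hf₃.isCausallySeparableLastFirst⟩, ?_⟩
  intro A' B' C' _ _ _ _ _ _ ρ hρ htr
  -- Unit trace rules out empty ancillas.
  have : Nonempty (A' × B' × C') := by
    by_contra hempty
    rw [not_nonempty_iff] at hempty
    simp [Matrix.trace] at htr
  obtain ⟨a, b, c⟩ := this
  have : Nonempty A' := ⟨a⟩
  have : Nonempty B' := ⟨b⟩
  have : Nonempty C' := ⟨c⟩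
  refine ⟨q₁, q₂, q₃, extend W₁ ρ, extend W₂ ρ, extend W₃ ρ, h₁, h₂, h₃, hq, ?_,
    (hf₁.extend hρ htr).isCausallySeparableLastFirst, ?_, ?_⟩
  · rw [hW]
    ext x y
    simp only [extend, Matrix.of_apply, Matrix.add_apply, Matrix.smul_apply, Complex.real_smul]
    ring
  · rw [toACB_extend]
    exact (hf₂.extend (toACB_posSemidef_iff.2 hρ)
      ((trace_toACB ρ).trans htr)).isCausallySeparableLastFirst
  · rw [toBCA_extend]
    exact (hf₃.extend (toBCA_posSemidef_iff.2 hρ)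
      ((trace_toBCA ρ).trans htr)).isCausallySeparableLastFirst

/-- White noise is in canonical form. -/
lemma hasLastFirstForm_white [Nonempty A1] [Nonempty A2] [Nonempty B1] [Nonempty B2]
    [Nonempty C1] [Nonempty C2] {c : ℝ}
    (hc : c = ((Fintype.card A1 : ℝ) * Fintype.card B1 * Fintype.card C1)⁻¹) :
    HasLastFirstForm ((c : ℂ) •
      (1 : Matrix ((A1 × A2) × (B1 × B2) × (C1 × C2)) ((A1 × A2) × (B1 × B2) × (C1 × C2)) ℂ)) := by
  have hc0 : (0 : ℂ) ≤ c := by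
    rw [hc]; exact_mod_cast (by positivity)
  have htr : ∀ {n m : Type} [Fintype n] [Fintype m] (X : Matrix (n × m) (n × m) ℂ),
      X.trace = (trOut X).trace := fun {n m} _ _ X => by
    simp [Matrix.trace, trOut, Fintype.sum_prod_type]
  have hprob : ∀ X Y Z, prob₃ ((c : ℂ) • (1 : Matrix ((A1 × A2) × (B1 × B2) × (C1 × C2))
      ((A1 × A2) × (B1 × B2) × (C1 × C2)) ℂ)) X Y Z =
      c * ((trOut X).trace * ((trOut Y).trace * (trOut Z).trace)) := fun X Y Z => by
    rw [prob₃, Matrix.smul_mul, one_mul, Matrix.trace_smul, Matrix.trace_kronecker,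
      Matrix.trace_kronecker, htr X, htr Y, htr Z, smul_eq_mul]
  have hn : IsNormalized ((c : ℂ) • (1 : Matrix ((A1 × A2) × (B1 × B2) × (C1 × C2))
      ((A1 × A2) × (B1 × B2) × (C1 × C2)) ℂ)) := fun X Y Z x y z hX hY hZ => by
    rw [hprob, hX, hY, hZ, hc]
    simp only [Matrix.trace_smul, Matrix.trace_one, smul_eq_mul]
    have h1 : (Fintype.card A1 : ℂ) ≠ 0 := by simp
    have h2 : (Fintype.card B1 : ℂ) ≠ 0 := by simp
    have h3 : (Fintype.card C1 : ℂ) ≠ 0 := by simp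
    push_cast
    field_simp
  have hns : IsNoSigLinear ((c : ℂ) • (1 : Matrix ((A1 × A2) × (B1 × B2) × (C1 × C2))
      ((A1 × A2) × (B1 × B2) × (C1 × C2)) ℂ)) :=
    ⟨fun X Y Z y hX _ => by rw [hprob, hX]; simp, fun X Y Z x _ hY => by rw [hprob, hY]; simp⟩
  refine ⟨isProcMatrix₃_iff.2 ⟨Matrix.PosSemidef.one.smul hc0, hn⟩, hns.onlyCFirstTerms hn,
    (c : ℂ) • 1, 0, Matrix.PosSemidef.one.smul hc0, Matrix.PosSemidef.zero, ?_⟩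
  ext ⟨⟨a, a'⟩, b⟩ ⟨⟨d, d'⟩, e⟩
  by_cases h1 : a = d <;> by_cases h2 : a' = d' <;> by_cases h3 : b = e <;>
    simp [idA2, idB2, Matrix.one_apply, h1, h2, h3, Prod.ext_iff]
  simp_all [Prod.ext_iff]

end Extension

/-! ### Positive operators below a product with a pure state -/

section Domination

/-- `⟨v, Gv⟩` is a sum of two nonnegative terms, so `⟨v, Vv⟩ = 0`, and for positive `V` this means
`Vv = 0`. -/
lemma mulVec_eq_zero_of_dominated {n : Type} [Fintype n] {G V R : Matrix n n ℂ} {q : ℝ}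
    (hq : 0 < q) (hV : V.PosSemidef) (hR : R.PosSemidef) (hG : G = q • V + R) {v : n → ℂ}
    (hv : star v ⬝ᵥ (G.mulVec v) = 0) : V.mulVec v = 0 := by
  rw [← hV.dotProduct_mulVec_zero_iff]
  have h1 := hV.dotProduct_mulVec_nonneg v
  have h2 := hR.dotProduct_mulVec_nonneg v
  rw [hG, Matrix.add_mulVec, dotProduct_add, Matrix.smul_mulVec, dotProduct_smul,
    Complex.real_smul] at hv
  have hq' : (0 : ℂ) < q := by exact_mod_cast hq
  have h3 := (add_eq_zero_iff_of_nonneg (mul_nonneg hq'.le h1) h2).1 hv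
  exact (mul_eq_zero.1 h3.1).resolve_left hq'.ne'

/-- Here `ρ` is a multiple of the rank-one operator on the indicator vector of `d`. The quadratic
form of `W ⊗ ρ` vanishes at `y ⊗ v` for `v` outside `d` and at `y ⊗ (v - u₀)` for `v` in `d`, so `V`
annihilates these vectors. This fixes the columns of `V`; Hermiticity fixes the rows. -/
lemma eq_kronecker_of_dominated {n U : Type} [Fintype n] [Fintype U] [DecidableEq n]
    [DecidableEq U] {d : U → Prop} [DecidablePred d] {u₀ : U} (hu₀ : d u₀) {c : ℂ}
    {W : Matrix n n ℂ} {ρ : Matrix U U ℂ}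
    (hρ : ∀ u v, ρ u v = c * ((if d u then 1 else 0) * (if d v then 1 else 0)))
    {V R : Matrix (n × U) (n × U) ℂ} {q : ℝ} (hq : 0 < q) (hV : V.PosSemidef)
    (hR : R.PosSemidef) (hG : W ⊗ₖ ρ = q • V + R) (p p' : n × U) :
    V p p' = ((if d p.2 then 1 else 0) * (if d p'.2 then 1 else 0)) * V (p.1, u₀) (p'.1, u₀) := by
  have hcol : ∀ (p : n × U) y v, V p (y, v) = (if d v then 1 else 0) * V p (y, u₀) := by
    intro p y v
    by_cases hv : d v
    · have h := congrFun (mulVec_eq_zero_of_dominated hq hV hR hG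
        (v := Pi.single (y, v) 1 - Pi.single (y, u₀) 1) (by
          simp [Matrix.mulVec_sub, sub_dotProduct, hρ, hv, hu₀])) p
      simp [Matrix.mulVec_sub, sub_eq_zero] at h
      simp [hv, h]
    · have h := congrFun (mulVec_eq_zero_of_dominated hq hV hR hG
        (v := Pi.single (y, v) 1) (by simp [hρ, hv])) p
      simp at h
      simp [hv, h]
  obtain ⟨x, u⟩ := p
  obtain ⟨y, v⟩ := p'
  have hrow : V (x, u) (y, u₀) = (if d u then 1 else 0) * V (x, u₀) (y, u₀) := by
    rw [← hV.isHermitian.apply (x, u), hcol, ← hV.isHermitian.apply (x, u₀)]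
    by_cases hu : d u <;> simp [hu]
  rw [hcol, hrow]
  ring

end Domination

/-! ### Extension by a Greenberger-Horne-Zeilinger state -/

section GHZ

variable {K : Type} [Fintype K] [DecidableEq K]

variable (K) in
/-- The tripartite Greenberger-Horne-Zeilinger state. -/
def ghz : Matrix (K × K × K) (K × K × K) ℂ :=
  Matrix.of fun u v => (Fintype.card K : ℂ)⁻¹ *
    ((if u.1 = u.2.1 ∧ u.2.1 = u.2.2 then 1 else 0) *
      (if v.1 = v.2.1 ∧ v.2.1 = v.2.2 then 1 else 0))

lemma ghz_posSemidef : (ghz K).PosSemidef := by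
  have h := (Matrix.posSemidef_vecMulVec_self_star
    (fun u : K × K × K => if u.1 = u.2.1 ∧ u.2.1 = u.2.2 then (1 : ℂ) else 0)).smul
    (a := (Fintype.card K : ℂ)⁻¹) (by
      rw [← Complex.ofReal_natCast, ← Complex.ofReal_inv]
      exact_mod_cast inv_nonneg.2 (Nat.cast_nonneg _))
  refine Eq.mp (congrArg Matrix.PosSemidef ?_) h
  ext u v
  simp [ghz, Matrix.vecMulVec_apply, apply_ite star]

lemma ghz_trace [Nonempty K] : (ghz K).trace = 1 := by
  have h : ∀ i j k : K, ghz K (i, j, k) (i, j, k) =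
      if i = j then (if j = k then (Fintype.card K : ℂ)⁻¹ else 0) else 0 := fun i j k => by
    by_cases h1 : i = j
    · subst h1
      by_cases h2 : i = k <;> simp [ghz, h2]
    · simp [ghz, h1]
  simp [Matrix.trace, Fintype.sum_prod_type, h]

lemma toACB_ghz : toACB (ghz K) = ghz K := by
  have h : ∀ u : K × K × K, (u.1 = u.2.2 ∧ u.2.2 = u.2.1) ↔ (u.1 = u.2.1 ∧ u.2.1 = u.2.2) := by
    rintro ⟨i, j, k⟩
    constructor <;> rintro ⟨h1, h2⟩ <;> simp_all
  ext u v
  simp [toACB, ghz, h]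

lemma toBCA_ghz : toBCA (ghz K) = ghz K := by
  have h : ∀ u : K × K × K, (u.2.2 = u.1 ∧ u.1 = u.2.1) ↔ (u.1 = u.2.1 ∧ u.2.1 = u.2.2) := by
    rintro ⟨i, j, k⟩
    constructor <;> rintro ⟨h1, h2⟩ <;> simp_all
  ext u v
  simp [toBCA, ghz, h]

variable {A1 A2 B1 B2 C1 C2 : Type}
  [Fintype A1] [DecidableEq A1] [Fintype A2] [DecidableEq A2]
  [Fintype B1] [DecidableEq B1] [Fintype B2] [DecidableEq B2]
  [Fintype C1] [DecidableEq C1] [Fintype C2] [DecidableEq C2]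
  {W : Matrix ((A1 × A2) × (B1 × B2) × (C1 × C2)) ((A1 × A2) × (B1 × B2) × (C1 × C2)) ℂ}

lemma extend_ghz_apply (k : K) (x y : (A1 × A2) × (B1 × B2) × (C1 × C2)) :
    extend W (ghz K) (extendEquiv A1 A2 B1 B2 C1 C2 K K K (x, k, k, k))
      (extendEquiv A1 A2 B1 B2 C1 C2 K K K (y, k, k, k)) = W x y * (Fintype.card K : ℂ)⁻¹ := by
  simp [extend, extendEquiv, ghz]

/-- Positive components of `W ⊗ GHZ` are themselves extensions by the GHZ state. -/
lemma exists_eq_extend_ghz [Nonempty K]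
    {V R : Matrix (((A1 × K) × A2) × ((B1 × K) × B2) × ((C1 × K) × C2))
      (((A1 × K) × A2) × ((B1 × K) × B2) × ((C1 × K) × C2)) ℂ} {q : ℝ} (hq : 0 < q)
    (hV : V.PosSemidef) (hR : R.PosSemidef) (hG : extend W (ghz K) = q • V + R) :
    ∃ F : Matrix ((A1 × A2) × (B1 × B2) × (C1 × C2)) ((A1 × A2) × (B1 × B2) × (C1 × C2)) ℂ,
      V = extend F (ghz K) := by
  obtain ⟨k⟩ := ‹Nonempty K›
  let e := extendEquiv A1 A2 B1 B2 C1 C2 K K K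
  have h := eq_kronecker_of_dominated (W := W) (ρ := ghz K) (u₀ := (k, k, k))
    (c := (Fintype.card K : ℂ)⁻¹) (d := fun u => u.1 = u.2.1 ∧ u.2.1 = u.2.2) ⟨rfl, rfl⟩
    (fun u v => by rw [ghz, Matrix.of_apply]) hq
    (hV.submatrix e) (hR.submatrix e) (by
      rw [← extend_submatrix_extendEquiv, hG]; rfl)
  -- The factor `card K` cancels the normalization of the GHZ state.
  refine ⟨Matrix.of fun x y => (Fintype.card K : ℂ) * V (e (x, k, k, k)) (e (y, k, k, k)), ?_⟩
  ext x y
  have hK : (Fintype.card K : ℂ) ≠ 0 := by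
    have : Nonempty K := ⟨k⟩
    simp
  have h1 := h (e.symm x) (e.symm y)
  simp only [Matrix.submatrix_apply, Equiv.apply_symm_apply] at h1
  rw [h1]
  simp only [extend, Matrix.of_apply, ghz]
  simp only [e, extendEquiv, Equiv.coe_fn_mk, Equiv.coe_fn_symm_mk]
  field_simp

/-- Trivial extension of a local operator to an ancilla. -/
def ancillaOne {X1 X2 : Type} (K : Type) [DecidableEq K] (X : Matrix (X1 × X2) (X1 × X2) ℂ) :
    Matrix ((X1 × K) × X2) ((X1 × K) × X2) ℂ :=
  Matrix.of fun p q => (1 : Matrix K K ℂ) p.1.2 q.1.2 * X (p.1.1, p.2) (q.1.1, q.2)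

lemma trOut_ancillaOne {X1 X2 : Type} [Fintype X2] [DecidableEq X1]
    {X : Matrix (X1 × X2) (X1 × X2) ℂ} {x : ℂ} (hX : trOut X = x • 1) :
    trOut (ancillaOne K X) = x • 1 := by
  ext ⟨a, i⟩ ⟨b, j⟩
  have := congrFun (congrFun hX a) b
  simp only [trOut, Matrix.of_apply] at this
  have h1 : trOut (ancillaOne K X) (a, i) (b, j) = (1 : Matrix K K ℂ) i j * ∑ k, X (a, k) (b, k) := by
    simp [trOut, ancillaOne, Finset.mul_sum]
  rw [h1, this]
  by_cases h1 : a = b <;> by_cases h2 : i = j <;> simp [Matrix.one_apply, h1, h2]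

lemma ancillaBlock_ancillaOne {X1 X2 : Type} (X : Matrix (X1 × X2) (X1 × X2) ℂ) (i j : K) :
    ancillaBlock (ancillaOne K X) i j = (1 : Matrix K K ℂ) i j • X := rfl

/-- Operations that ignore the ancillas see only `W`; normalization and no signaling descend from
the extension in this way. -/
lemma prob₃_extend_ancillaOne (X : Matrix (A1 × A2) (A1 × A2) ℂ) (Y : Matrix (B1 × B2) (B1 × B2) ℂ)
    (Z : Matrix (C1 × C2) (C1 × C2) ℂ) {ρ : Matrix (K × K × K) (K × K × K) ℂ}
    (hρ : ρ.trace = 1) :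
    prob₃ (extend W ρ) (ancillaOne K X) (ancillaOne K Y) (ancillaOne K Z) = prob₃ W X Y Z := by
  rw [prob₃_extend, ← one_mul (prob₃ W X Y Z), ← hρ, Matrix.trace, Finset.sum_mul]
  refine Finset.sum_congr rfl fun u _ => ?_
  simp only [ancillaBlock_ancillaOne]
  rw [Finset.sum_eq_single u]
  · simp
  · rintro ⟨i, j, k⟩ _ hv
    obtain ⟨i', j', k'⟩ := u
    simp only [← prob₃L_apply, map_smul, LinearMap.smul_apply, smul_eq_mul]
    by_cases h1 : i = i' <;> by_cases h2 : j = j' <;> by_cases h3 : k = k' <;>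
      simp [Matrix.one_apply, h1, h2, h3]
    simp_all
  · simp

/-- An operation of Charlie on his ancilla and the original systems that transfers the original
systems to the ancillas of Alice and Bob. -/
def swapEffect (e : C1 × C2 → K) : Matrix ((C1 × K) × C2) ((C1 × K) × C2) ℂ :=
  Matrix.vecMulVec (fun p => if p.1.2 = e (p.1.1, p.2) then (1 : ℂ) else 0)
    (star fun p => if p.1.2 = e (p.1.1, p.2) then (1 : ℂ) else 0)

/-- GHZ forces Charlie's ancilla to equal the value `e c` held by Alice and Bob, and the effect
forces it to encode his own laboratory index. By injectivity that index is `c`, so both sums over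
Charlie collapse to one term and coherences between different `c` are kept. -/
lemma traceC_extend_ghz_swapEffect {e : C1 × C2 → K} (he : Function.Injective e) (ε : ℂ)
    (x y : (A1 × A2) × (B1 × B2) × (C1 × C2)) :
    traceC (extend W (ghz K)) (ε • swapEffect e)
      (((x.1.1, e x.2.2), x.1.2), ((x.2.1.1, e x.2.2), x.2.1.2))
      (((y.1.1, e y.2.2), y.1.2), ((y.2.1.1, e y.2.2), y.2.1.2)) =
    ε * (Fintype.card K : ℂ)⁻¹ * W x y := by
  obtain ⟨a, b, c⟩ := x
  obtain ⟨a', b', c'⟩ := y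
  simp only [traceC, Matrix.of_apply]
  have hz : ∀ (d : (C1 × K) × C2) (c : C1 × C2), d ≠ ((c.1, e c), c.2) →
      e c = d.1.2 → d.1.2 ≠ e (d.1.1, d.2) := by
    rintro ⟨⟨i, k⟩, j⟩ ⟨i', j'⟩ hd h1 h2
    obtain ⟨rfl, rfl⟩ := Prod.mk.inj (he (h1.trans h2))
    exact hd (by simp [h1])
  rw [Finset.sum_eq_single ((c.1, e c), c.2), Finset.sum_eq_single ((c'.1, e c'), c'.2)]
  · simp [extend, ghz, swapEffect, Matrix.vecMulVec_apply]
    ring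
  · intro d _ hd
    have := hz d c' hd
    by_cases h1 : e c' = d.1.2
    · simp [swapEffect, Matrix.vecMulVec_apply, this h1]
    · simp [extend, ghz, h1]
  · simp
  · intro d _ hd
    have := hz d c hd
    refine Finset.sum_eq_zero fun d' _ => ?_
    by_cases h1 : e c = d.1.2
    · simp [swapEffect, Matrix.vecMulVec_apply, this h1]
    · simp [extend, ghz, h1]
  · simp

/-- The unnormalized conditional process of a causally separable process with the third party first
is a sum of two positive operators, trivial on the outputs of the first and second party. -/
lemma IsCausallySeparableLastFirst.exists_traceC_eq [Nonempty A2] [Nonempty B2]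
    (h : IsCausallySeparableLastFirst W) {M : Matrix (C1 × C2) (C1 × C2) ℂ} (hM : IsEvent M) :
    ∃ (R : Matrix (A1 × (B1 × B2)) (A1 × (B1 × B2)) ℂ)
      (R' : Matrix ((A1 × A2) × B1) ((A1 × A2) × B1) ℂ), R.PosSemidef ∧ R'.PosSemidef ∧
      ∀ x y, traceC W M x y = (1 : Matrix A2 A2 ℂ) x.1.2 y.1.2 * R (x.1.1, x.2) (y.1.1, y.2) +
        (1 : Matrix B2 B2 ℂ) x.2.2 y.2.2 * R' (x.1, x.2.1) (y.1, y.2.1) := by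
  have hpos := traceC_posSemidef h.1.1 hM.1
  have htr := trace_traceC W M
  have hd : (Fintype.card A2 : ℂ) * (Fintype.card B2 : ℂ) ≠ 0 := by simp
  have hd0 : (0 : ℂ) ≤ ((Fintype.card A2 : ℂ) * (Fintype.card B2 : ℂ))⁻¹ := by
    rw [← Complex.ofReal_natCast, ← Complex.ofReal_natCast, ← Complex.ofReal_mul,
      ← Complex.ofReal_inv]
    exact_mod_cast (by positivity)
  -- At zero probability separability of the conditional says nothing, but the positive operator
  -- `traceC W M` then has zero trace and vanishes.
  by_cases hp : probC W M = 0
  · rw [hp, mul_eq_zero] at htr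
    have h0 := hpos.trace_eq_zero_iff.1 (htr.resolve_left (inv_ne_zero hd))
    exact ⟨0, 0, Matrix.PosSemidef.zero, Matrix.PosSemidef.zero, by simp [h0]⟩
  · have hp0 : 0 ≤ probC W M := htr ▸ mul_nonneg hd0 hpos.trace_nonneg
    obtain ⟨q, V, V', hq0, hq1, hV, ⟨hVp, hVs⟩, ⟨hVp', hVs'⟩⟩ := h.2.2 M hM hp
    obtain ⟨R, hR, hVR⟩ := exists_eq_one_tensor_of_noSigAtoB hVs hVp.1
    obtain ⟨R', hR', hVR'⟩ := exists_eq_tensor_one_of_noSigBtoA hVs' hVp'.1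
    have hq0' : (0 : ℂ) ≤ q := by exact_mod_cast hq0
    have hq1' : (0 : ℂ) ≤ (1 - q : ℝ) := by exact_mod_cast sub_nonneg.2 hq1
    refine ⟨(probC W M * q) • R, (probC W M * (1 - q : ℝ)) • R', hR.smul (mul_nonneg hp0 hq0'),
      hR'.smul (mul_nonneg hp0 hq1'), fun x y => ?_⟩
    have h1 : traceC W M x y = probC W M * condAB W M x y := by
      simp [condAB, hp]
    rw [h1, hV]
    simp only [Matrix.add_apply, Matrix.smul_apply, Complex.real_smul, smul_eq_mul, hVR, hVR']
    ring

/-- If the extension of `W` by a sufficiently large GHZ state is causally separable with the third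
party first, then `W` is in canonical form. -/
lemma hasLastFirstForm_of_extend_ghz [Nonempty K] [Nonempty A2] [Nonempty B2] [Nonempty C2]
    {e : C1 × C2 → K} (he : Function.Injective e)
    (h : IsCausallySeparableLastFirst (extend W (ghz K))) : HasLastFirstForm W := by
  obtain ⟨hpos, hnorm⟩ := isProcMatrix₃_iff.1 h.1
  have hns := noSigABtoC_iff.1 h.2.1
  have hK : (Fintype.card K : ℂ) ≠ 0 := by simp
  -- `W` is `card K` times the compression of its extension to the ancilla index `(k, k, k)`.
  have hW : W.PosSemidef := by
    obtain ⟨k⟩ := ‹Nonempty K›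
    have h1 := (hpos.submatrix fun x => extendEquiv A1 A2 B1 B2 C1 C2 K K K (x, k, k, k)).smul
      (a := (Fintype.card K : ℂ)) (by exact_mod_cast Nat.zero_le _)
    refine Eq.mp (congrArg Matrix.PosSemidef ?_) h1
    ext x y
    simp only [Matrix.smul_apply, Matrix.submatrix_apply, smul_eq_mul]
    rw [extend_ghz_apply]
    field_simp
  have hn : IsNormalized W := fun X Y Z x y z hX hY hZ => by
    rw [← prob₃_extend_ancillaOne X Y Z (ghz_trace (K := K))]
    exact hnorm _ _ _ x y z (trOut_ancillaOne hX) (trOut_ancillaOne hY) (trOut_ancillaOne hZ)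
  have h0 : ∀ {X1 X2 : Type} [Fintype X2] [DecidableEq X1] {X : Matrix (X1 × X2) (X1 × X2) ℂ},
      trOut X = 0 → trOut (ancillaOne K X) = 0 := fun {X1 X2} _ _ {X} hX => by
    simpa using trOut_ancillaOne (K := K) (x := 0) (hX.trans (zero_smul ℂ _).symm)
  have hs : IsNoSigLinear W := by
    constructor
    · intro X Y Z y hX hY
      rw [← prob₃_extend_ancillaOne X Y Z (ghz_trace (K := K))]
      exact hns.1 _ _ _ y (h0 hX) (trOut_ancillaOne hY)
    · intro X Y Z x hX hY
      rw [← prob₃_extend_ancillaOne X Y Z (ghz_trace (K := K))]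
      exact hns.2 _ _ _ x (trOut_ancillaOne hX) (h0 hY)
  refine ⟨isProcMatrix₃_iff.2 ⟨hW, hn⟩, hs.onlyCFirstTerms hn, ?_⟩
  obtain ⟨ε, hε, hM⟩ := exists_pos_smul_isEvent
    (show (swapEffect e).PosSemidef from Matrix.posSemidef_vecMulVec_self_star _)
  obtain ⟨R, R', hR, hR', hRR⟩ := h.exists_traceC_eq hM
  have hc : (0 : ℂ) ≤ (ε : ℂ)⁻¹ * Fintype.card K := by
    rw [← Complex.ofReal_natCast, ← Complex.ofReal_inv, ← Complex.ofReal_mul]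
    exact_mod_cast (by positivity)
  have hεC : (ε : ℂ) ≠ 0 := by exact_mod_cast hε.ne'
  -- `R` and `R'` are compressed to the indices where both ancillas hold `e c`, and `c` is read as
  -- Charlie's index. The scalar undoes the factor `ε / card K`.
  refine ⟨((ε : ℂ)⁻¹ * Fintype.card K) • R.submatrix
      (fun x : A1 × (B1 × B2) × (C1 × C2) => ((x.1, e x.2.2), ((x.2.1.1, e x.2.2), x.2.1.2)))
      (fun x : A1 × (B1 × B2) × (C1 × C2) => ((x.1, e x.2.2), ((x.2.1.1, e x.2.2), x.2.1.2))),
    ((ε : ℂ)⁻¹ * Fintype.card K) • R'.submatrix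
      (fun x : (A1 × A2) × B1 × (C1 × C2) => (((x.1.1, e x.2.2), x.1.2), (x.2.1, e x.2.2)))
      (fun x : (A1 × A2) × B1 × (C1 × C2) => (((x.1.1, e x.2.2), x.1.2), (x.2.1, e x.2.2))),
    (hR.submatrix _).smul hc, (hR'.submatrix _).smul hc, ?_⟩
  ext x y
  have h1 := traceC_extend_ghz_swapEffect (W := W) he (ε : ℂ) x y
  rw [hRR] at h1
  have h2 : W x y = (ε : ℂ)⁻¹ * Fintype.card K * (ε * (Fintype.card K : ℂ)⁻¹ * W x y) := by
    field_simp
  rw [h2, ← h1]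
  simp only [idA2, idB2, Matrix.add_apply, Matrix.of_apply, Matrix.smul_apply,
    Matrix.submatrix_apply, smul_eq_mul]
  ring

/-- A component of a causal decomposition of `W ⊗ GHZ` is the extension of a process in canonical
form, or has weight zero. -/
lemma exists_hasLastFirstForm_component [Nonempty K] [Nonempty A1] [Nonempty A2] [Nonempty B1]
    [Nonempty B2] [Nonempty C1] [Nonempty C2] {e : C1 × C2 → K} (he : Function.Injective e)
    {V R : Matrix (((A1 × K) × A2) × ((B1 × K) × B2) × ((C1 × K) × C2))
      (((A1 × K) × A2) × ((B1 × K) × B2) × ((C1 × K) × C2)) ℂ} {q : ℝ} (hq : 0 ≤ q)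
    (hV : IsCausallySeparableLastFirst V) (hR : R.PosSemidef)
    (hG : extend W (ghz K) = q • V + R) :
    ∃ F : Matrix ((A1 × A2) × (B1 × B2) × (C1 × C2)) ((A1 × A2) × (B1 × B2) × (C1 × C2)) ℂ,
      HasLastFirstForm F ∧ q • V = q • extend F (ghz K) := by
  -- Domination gives nothing at weight zero, so white noise is used there.
  obtain rfl | hq := hq.eq_or_lt
  · exact ⟨_, hasLastFirstForm_white rfl, by simp⟩
  · obtain ⟨F, rfl⟩ := exists_eq_extend_ghz hq hV.1.1 hR hG
    exact ⟨F, hasLastFirstForm_of_extend_ghz he hV, rfl⟩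

/-! ### Assembling the three causal orders -/

lemma toACB_combination {α β γ : Type} (q : ℝ) (V R : Matrix (α × β × γ) (α × β × γ) ℂ) :
    toACB (q • V + R) = q • toACB V + toACB R := rfl

lemma toBCA_combination {α β γ : Type} (q : ℝ) (V R : Matrix (α × β × γ) (α × β × γ) ℂ) :
    toBCA (q • V + R) = q • toBCA V + toBCA R := rfl

/-- Extensibly causally separable processes are convex combinations of canonical forms. -/
lemma IsECS.exists_hasLastFirstForm [Nonempty A1] [Nonempty A2] [Nonempty B1] [Nonempty B2]
    [Nonempty C1] [Nonempty C2] (h : IsECS W) :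
    ∃ (q₁ q₂ q₃ : ℝ)
      (W₁ W₂ W₃ :
        Matrix ((A1 × A2) × (B1 × B2) × (C1 × C2)) ((A1 × A2) × (B1 × B2) × (C1 × C2)) ℂ),
      0 ≤ q₁ ∧ 0 ≤ q₂ ∧ 0 ≤ q₃ ∧ q₁ + q₂ + q₃ = 1 ∧
      W = q₁ • W₁ + q₂ • W₂ + q₃ • W₃ ∧
      HasLastFirstForm W₁ ∧ HasLastFirstForm (toACB W₂) ∧ HasLastFirstForm (toBCA W₃) := by
  -- The disjoint union receives an injection from each laboratory, so any party can play Charlie's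
  -- role with the same GHZ state.
  let K := (A1 × A2) ⊕ (B1 × B2) ⊕ (C1 × C2)
  obtain ⟨q₁, q₂, q₃, V₁, V₂, V₃, h₁, h₂, h₃, hq, hG, hV₁, hV₂, hV₃⟩ :=
    h.2 K K K (ghz K) ghz_posSemidef ghz_trace
  have hp₁ := hV₁.1.1
  have hp₂ := toACB_posSemidef_iff.1 hV₂.1.1
  have hp₃ := toBCA_posSemidef_iff.1 hV₃.1.1
  have hsm : ∀ {n : Type} [Fintype n] {V : Matrix n n ℂ} {q : ℝ}, V.PosSemidef → 0 ≤ q →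
      (q • V).PosSemidef := fun {n} _ {V q} hV hq => by
    have := hV.smul (a := (q : ℂ)) (by exact_mod_cast hq)
    rwa [Complex.coe_smul] at this
  obtain ⟨F₁, hF₁, hE₁⟩ := exists_hasLastFirstForm_component (W := W) (K := K)
    (e := fun c => Sum.inr (Sum.inr c)) (fun _ _ h => Sum.inr_injective (Sum.inr_injective h))
    h₁ hV₁ ((hsm hp₂ h₂).add (hsm hp₃ h₃)) (by rw [hG, add_assoc])
  obtain ⟨F₂, hF₂, hE₂⟩ := exists_hasLastFirstForm_component (W := toACB W) (K := K)
    (e := fun c => Sum.inr (Sum.inl c)) (fun _ _ h => Sum.inl_injective (Sum.inr_injective h))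
    h₂ hV₂ (toACB_posSemidef_iff.2 ((hsm hp₁ h₁).add (hsm hp₃ h₃)))
    (by
      conv_lhs => rw [← toACB_ghz, ← toACB_extend]
      rw [hG, ← toACB_combination, add_comm (q₁ • V₁), add_assoc])
  obtain ⟨F₃, hF₃, hE₃⟩ := exists_hasLastFirstForm_component (W := toBCA W) (K := K)
    (e := fun c => Sum.inl c) Sum.inl_injective
    h₃ hV₃ (toBCA_posSemidef_iff.2 ((hsm hp₁ h₁).add (hsm hp₂ h₂)))
    (by
      conv_lhs => rw [← toBCA_ghz, ← toBCA_extend]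
      rw [hG, ← toBCA_combination, add_comm (q₃ • V₃)])
  refine ⟨q₁, q₂, q₃, F₁, F₂.submatrix (fun x => (x.1, x.2.2, x.2.1)) (fun x => (x.1, x.2.2, x.2.1)),
    F₃.submatrix (fun x => (x.2.1, x.2.2, x.1)) (fun x => (x.2.1, x.2.2, x.1)),
    h₁, h₂, h₃, hq, ?_, hF₁, hF₂, hF₃⟩
  -- The identity for `W` is read off the decomposition of `W ⊗ GHZ` at one diagonal ancilla index,
  -- after cancelling the common factor `1 / card K`.
  have k : K := Classical.arbitrary K
  have hK : (Fintype.card K : ℂ) ≠ 0 := by simp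
  ext x y
  have e₁ := congrFun (congrFun hE₁ (extendEquiv A1 A2 B1 B2 C1 C2 K K K (x, k, k, k)))
    (extendEquiv A1 A2 B1 B2 C1 C2 K K K (y, k, k, k))
  have e₂ := congrFun (congrFun hE₂
    (extendEquiv A1 A2 C1 C2 B1 B2 K K K ((x.1, x.2.2, x.2.1), k, k, k)))
    (extendEquiv A1 A2 C1 C2 B1 B2 K K K ((y.1, y.2.2, y.2.1), k, k, k))
  have e₃ := congrFun (congrFun hE₃
    (extendEquiv B1 B2 C1 C2 A1 A2 K K K ((x.2.1, x.2.2, x.1), k, k, k)))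
    (extendEquiv B1 B2 C1 C2 A1 A2 K K K ((y.2.1, y.2.2, y.1), k, k, k))
  have hG' := congrFun (congrFun hG (extendEquiv A1 A2 B1 B2 C1 C2 K K K (x, k, k, k)))
    (extendEquiv A1 A2 B1 B2 C1 C2 K K K (y, k, k, k))
  rw [Matrix.smul_apply, Matrix.smul_apply, extend_ghz_apply] at e₁ e₂ e₃
  rw [extend_ghz_apply, Matrix.add_apply, Matrix.add_apply, Matrix.smul_apply, Matrix.smul_apply,
    Matrix.smul_apply] at hG'
  change q₂ • V₂ (extendEquiv A1 A2 B1 B2 C1 C2 K K K (x, k, k, k))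
    (extendEquiv A1 A2 B1 B2 C1 C2 K K K (y, k, k, k)) = _ at e₂
  change q₃ • V₃ (extendEquiv A1 A2 B1 B2 C1 C2 K K K (x, k, k, k))
    (extendEquiv A1 A2 B1 B2 C1 C2 K K K (y, k, k, k)) = _ at e₃
  rw [e₁, e₂, e₃] at hG'
  simp only [Complex.real_smul] at hG'
  simp only [Matrix.add_apply, Matrix.smul_apply, Matrix.submatrix_apply, Complex.real_smul]
  field_simp at hG'
  exact hG'

/-- These are fillers: each component is shown to be ECS as a convex combination with weight one on
itself, and the two slots of weight zero still need processes of the right forms. -/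
lemma exists_hasLastFirstForm [Nonempty A1] [Nonempty A2] [Nonempty B1] [Nonempty B2]
    [Nonempty C1] [Nonempty C2] :
    ∃ W₁ W₂ W₃ : Matrix ((A1 × A2) × (B1 × B2) × (C1 × C2)) ((A1 × A2) × (B1 × B2) × (C1 × C2)) ℂ,
      HasLastFirstForm W₁ ∧ HasLastFirstForm (toACB W₂) ∧ HasLastFirstForm (toBCA W₃) := by
  obtain ⟨F₁, h₁⟩ : ∃ F : Matrix ((A1 × A2) × (B1 × B2) × (C1 × C2))
    ((A1 × A2) × (B1 × B2) × (C1 × C2)) ℂ, HasLastFirstForm F := ⟨_, hasLastFirstForm_white rfl⟩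
  obtain ⟨F₂, h₂⟩ : ∃ F : Matrix ((A1 × A2) × (C1 × C2) × (B1 × B2))
    ((A1 × A2) × (C1 × C2) × (B1 × B2)) ℂ, HasLastFirstForm F := ⟨_, hasLastFirstForm_white rfl⟩
  obtain ⟨F₃, h₃⟩ : ∃ F : Matrix ((B1 × B2) × (C1 × C2) × (A1 × A2))
    ((B1 × B2) × (C1 × C2) × (A1 × A2)) ℂ, HasLastFirstForm F := ⟨_, hasLastFirstForm_white rfl⟩
  exact ⟨F₁, F₂.submatrix (fun x => (x.1, x.2.2, x.2.1)) (fun x => (x.1, x.2.2, x.2.1)),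
    F₃.submatrix (fun x => (x.2.1, x.2.2, x.1)) (fun x => (x.2.1, x.2.2, x.1)), h₁, h₂, h₃⟩

end GHZ

end ProcMat

end

/-! ### The characterization of ECS processes -/

theorem proposition3p3 {A1 A2 B1 B2 C1 C2 : Type}
    [Fintype A1] [DecidableEq A1] [Nonempty A1] [Fintype A2] [DecidableEq A2] [Nonempty A2]
    [Fintype B1] [DecidableEq B1] [Nonempty B1] [Fintype B2] [DecidableEq B2] [Nonempty B2]
    [Fintype C1] [DecidableEq C1] [Nonempty C1] [Fintype C2] [DecidableEq C2] [Nonempty C2]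
    (W : Matrix ((A1 × A2) × (B1 × B2) × (C1 × C2)) ((A1 × A2) × (B1 × B2) × (C1 × C2)) ℂ) :
    (ProcMat.IsECS W →
      ∃ (q₁ q₂ q₃ : ℝ)
        (W₁ W₂ W₃ :
          Matrix ((A1 × A2) × (B1 × B2) × (C1 × C2)) ((A1 × A2) × (B1 × B2) × (C1 × C2)) ℂ),
        0 ≤ q₁ ∧ 0 ≤ q₂ ∧ 0 ≤ q₃ ∧ q₁ + q₂ + q₃ = 1 ∧
        W = q₁ • W₁ + q₂ • W₂ + q₃ • W₃ ∧
        (ProcMat.IsECS W₁ ∧ ProcMat.IsCausallySeparableLastFirst W₁ ∧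
          ProcMat.HasLastFirstForm W₁) ∧
        (ProcMat.IsECS W₂ ∧ ProcMat.IsCausallySeparableLastFirst (ProcMat.toACB W₂) ∧
          ProcMat.HasLastFirstForm (ProcMat.toACB W₂)) ∧
        (ProcMat.IsECS W₃ ∧ ProcMat.IsCausallySeparableLastFirst (ProcMat.toBCA W₃) ∧
          ProcMat.HasLastFirstForm (ProcMat.toBCA W₃))) ∧
    ((∃ (q₁ q₂ q₃ : ℝ)
        (W₁ W₂ W₃ :
          Matrix ((A1 × A2) × (B1 × B2) × (C1 × C2)) ((A1 × A2) × (B1 × B2) × (C1 × C2)) ℂ),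
        0 ≤ q₁ ∧ 0 ≤ q₂ ∧ 0 ≤ q₃ ∧ q₁ + q₂ + q₃ = 1 ∧
        W = q₁ • W₁ + q₂ • W₂ + q₃ • W₃ ∧
        ProcMat.HasLastFirstForm W₁ ∧
        ProcMat.HasLastFirstForm (ProcMat.toACB W₂) ∧
        ProcMat.HasLastFirstForm (ProcMat.toBCA W₃)) →
      ProcMat.IsECS W) := by
  obtain ⟨U₁, U₂, U₃, hU₁, hU₂, hU₃⟩ := ProcMat.exists_hasLastFirstForm
    (A1 := A1) (A2 := A2) (B1 := B1) (B2 := B2) (C1 := C1) (C2 := C2)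
  refine ⟨fun h => ?_, ?_⟩
  · obtain ⟨q₁, q₂, q₃, W₁, W₂, W₃, h₁, h₂, h₃, hq, hW, hf₁, hf₂, hf₃⟩ := h.exists_hasLastFirstForm
    refine ⟨q₁, q₂, q₃, W₁, W₂, W₃, h₁, h₂, h₃, hq, hW,
      ⟨?_, hf₁.isCausallySeparableLastFirst, hf₁⟩, ⟨?_, hf₂.isCausallySeparableLastFirst, hf₂⟩,
      ⟨?_, hf₃.isCausallySeparableLastFirst, hf₃⟩⟩
    · exact ProcMat.isECS_of_hasLastFirstForm (q₁ := 1) (q₂ := 0) (q₃ := 0) zero_le_one le_rfl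
        le_rfl (by norm_num) (by simp) hf₁ hU₂ hU₃
    · exact ProcMat.isECS_of_hasLastFirstForm (q₁ := 0) (q₂ := 1) (q₃ := 0) le_rfl zero_le_one
        le_rfl (by norm_num) (by simp) hU₁ hf₂ hU₃
    · exact ProcMat.isECS_of_hasLastFirstForm (q₁ := 0) (q₂ := 0) (q₃ := 1) le_rfl le_rfl
        zero_le_one (by norm_num) (by simp) hU₁ hU₂ hf₃
  · rintro ⟨q₁, q₂, q₃, W₁, W₂, W₃, h₁, h₂, h₃, hq, hW, hf₁, hf₂, hf₃⟩
    exact ProcMat.isECS_of_hasLastFirstForm h₁ h₂ h₃ hq hW hf₁ hf₂ hf₃
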